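/- Let $\rho_\alpha,\rho_\beta\ge 1/2$ be real and let $n\ge 0$ be an integer. Then there is a configuration of angles $\theta_1^\ast,\dots,\theta_{2n}^\ast\in[0,2\pi)$ (repetitions allowed), unique up to the order of its elements, such that $$\max_{|z|=1}\Bigl|(z-1)^{2\rho_\alpha}(z+1)^{2\rho_\beta}\prod_{k=1}^{2n}\bigl(z-e^{i\theta_k^\ast}\bigr)\Bigr| = \min_{\theta_1,\dots,\theta_{2n}\in\mathbb{R}}\ \max_{|z|=1}\Bigl|(z-1)^{2\rho_\alpha}(z+1)^{2\rho_\beta}\prod_{k=1}^{2n}\bigl(z-e^{i\theta_k}\bigr)\Bigr|.$$ -/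

import Mathlib

/-- The modulus `|(z - 1)^{2ρα} (z + 1)^{2ρβ} ∏ₖ (z - e^{iθₖ})|` at the point `z`.
Since the exponents are real, the modulus does not depend on the branch of the powers. -/
noncomputable def nodeModulus {m : ℕ} (ρα ρβ : ℝ) (θ : Fin m → ℝ) (z : ℂ) : ℝ :=
  ‖(z - 1) ^ ((2 * ρα : ℝ) : ℂ) * (z + 1) ^ ((2 * ρβ : ℝ) : ℂ) *
    ∏ k, (z - Complex.exp (Complex.I * (θ k : ℂ)))‖

/-- The maximum over the unit circle of
`|(z - 1)^{2ρα} (z + 1)^{2ρβ} ∏ₖ (z - e^{iθₖ})|`. -/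
noncomputable def circleMax {m : ℕ} (ρα ρβ : ℝ) (θ : Fin m → ℝ) : ℝ :=
  sSup (nodeModulus ρα ρβ θ '' Metric.sphere (0 : ℂ) 1)

/-- The supremum defining `circleMax` is an attained maximum. -/
theorem circleMax_isGreatest {m : ℕ} {ρα ρβ : ℝ} (hα : 0 ≤ ρα) (hβ : 0 ≤ ρβ)
    (θ : Fin m → ℝ) :
    IsGreatest (nodeModulus ρα ρβ θ '' Metric.sphere (0 : ℂ) 1) (circleMax ρα ρβ θ) := by
  have hc : Continuous (nodeModulus ρα ρβ θ) := by
    have h : nodeModulus ρα ρβ θ = fun z : ℂ =>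
        ‖z - 1‖ ^ (2 * ρα) * ‖z + 1‖ ^ (2 * ρβ) *
          ‖∏ k, (z - Complex.exp (Complex.I * (θ k : ℂ)))‖ := by
      funext z
      rw [nodeModulus, norm_mul, norm_mul, Complex.norm_cpow_real, Complex.norm_cpow_real]
    rw [h]
    refine Continuous.mul (Continuous.mul ?_ ?_) ?_
    · exact Continuous.rpow_const (by fun_prop) fun _ => Or.inr (by positivity)
    · exact Continuous.rpow_const (by fun_prop) fun _ => Or.inr (by positivity)
    · fun_prop
  have hne : (Metric.sphere (0 : ℂ) 1).Nonempty := ⟨1, by simp⟩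
  exact ((isCompact_sphere (0 : ℂ) 1).image hc).isGreatest_sSup (hne.image _)

/-- The nodes `e^{iθ₁}, …, e^{iθₘ}` realize the minimum of `circleMax` over all configurations
of `m` nodes on the unit circle. -/
def IsMinimizingConfiguration {m : ℕ} (ρα ρβ : ℝ) (θ : Fin m → ℝ) : Prop :=
  IsLeast (Set.range fun φ : Fin m → ℝ => circleMax ρα ρβ φ) (circleMax ρα ρβ θ)

/-! At z = e^{iφ} the modulus equals w(φ)|T(φ)|, where w is `jacobiWeight` and T is `nodeFun θ`, a
real trigonometric polynomial of degree n whose top coefficient has modulus 1. The problem is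
relaxed: minimise sup |w f| over all real trigonometric polynomials f of degree at most n with top
coefficient of modulus at least 1. A minimiser exists by finite dimension
(`TrigRep.exists_isExtremal`). It suffices that it has 2n distinct real zeros per period and is
unique up to sign.

With the top coefficient frozen, Kolmogorov's criterion and Carathéodory's theorem give 2n
alternation points per period (`IsExtremal.exists_isAlternating`), hence 2n zeros. Two minimisers
with the same top coefficient coincide, since their difference has degree n - 1 and 2n weakly
alternating signs. The phase of the top coefficient is still free; it is pinned to ±1 by showing
that every minimiser is even (`IsExtremal.even`).

Suppose f is not even. Comparing f(φ) with f(-φ) forbids n + 1 alternation points in one half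
period, so each half carries exactly n. Comparison with an odd extremal polynomial then excludes
(-1)^n f(0) f(π) < 0 (`IsExtremal.false_of_sign`). The critical points of w f are zeros of Y =
sin·f' + ((a+b)cos + (a-b))f, of degree n + 1. Dividing Y by the half-angle sines of the alternation
points leaves g of degree 1, and g(0)g(π) > 0 would give the excluded sign. A further extremal point
that does not extend the alternation puts both zeros of g in one open half period, so g(0)g(π) > 0.
If there is no further extremal point, first-order variation of the top coefficient forces g = g(0)
+ s·sin. When g(0) ≠ 0 the excluded sign appears again. When g(0) = 0, (w f)' = -u w F with F of
degree n and u = n + a + b, and the second-order variation f + γF - γ²F'/(2u) beats the minimum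
(`IsExtremal.false_of_derivative`). -/

open Polynomial

/-! ### Real trigonometric polynomials as polynomials on the unit circle. -/

/-- The point `e^{iφ}` of the unit circle. -/
noncomputable def cis (φ : ℝ) : ℂ := Complex.exp (φ * Complex.I)

theorem cis_add (a b : ℝ) : cis (a + b) = cis a * cis b := by
  simp [cis, add_mul, Complex.exp_add]

theorem cis_zero : cis 0 = 1 := by simp [cis]

theorem cis_ne_zero (a : ℝ) : cis a ≠ 0 := Complex.exp_ne_zero _

theorem norm_cis (a : ℝ) : ‖cis a‖ = 1 := by simp [cis, Complex.norm_exp_ofReal_mul_I]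

theorem cis_neg (a : ℝ) : cis (-a) = (cis a)⁻¹ := by
  simp [cis, Complex.exp_neg]

theorem conj_cis (a : ℝ) : (starRingEnd ℂ) (cis a) = cis (-a) := by
  simp [cis, ← Complex.exp_conj]

theorem cis_eq (a : ℝ) : cis a = Real.cos a + Real.sin a * Complex.I := by
  simp [cis, Complex.exp_mul_I]

theorem cis_two_pi : cis (2 * Real.pi) = 1 := by
  simp [cis_eq]

theorem cis_nat_mul (n : ℕ) (a : ℝ) : cis (n * a) = cis a ^ n := by
  simp only [cis, ← Complex.exp_nat_mul]; push_cast; ring_nf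

theorem cis_pow (n : ℕ) (a : ℝ) : cis a ^ n = cis (n * a) := (cis_nat_mul n a).symm

theorem cis_injective_of_abs_lt {a b : ℝ} (h : |a - b| < 2 * Real.pi) (hab : cis a = cis b) :
    a = b := by
  have h1 : cis (a - b) = 1 := by
    rw [sub_eq_add_neg, cis_add, cis_neg, hab, mul_inv_cancel₀ (cis_ne_zero b)]
  have h2 : Real.cos (a - b) = 1 := by
    have := congrArg Complex.re h1
    rwa [cis_eq, Complex.add_re, Complex.re_ofReal_mul, Complex.ofReal_re, Complex.I_re, mul_zero,
      add_zero, Complex.one_re] at this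
  rw [abs_lt] at h
  have := (Real.cos_eq_one_iff_of_lt_of_lt (by linarith) h.2).1 h2
  linarith

theorem continuous_cis : Continuous cis := by unfold cis; fun_prop

theorem hasDerivAt_cis (φ : ℝ) : HasDerivAt cis (Complex.I * cis φ) φ := by
  have h1 : HasDerivAt (fun x : ℝ => (x : ℂ) * Complex.I) Complex.I φ := by
    simpa using (Complex.ofRealCLM.hasDerivAt (x := φ)).mul_const Complex.I
  have := h1.cexp
  rw [mul_comm]; exact this

theorem poly_eq_of_eval_cis {p q : ℂ[X]} (h : ∀ φ, p.eval (cis φ) = q.eval (cis φ)) : p = q := by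
  apply Polynomial.eq_of_infinite_eval_eq
  have hinf : (cis '' Set.Ioo 0 1).Infinite := by
    refine Set.Infinite.image ?_ (Set.Ioo_infinite one_pos)
    intro a ha b hb hab
    refine cis_injective_of_abs_lt ?_ hab
    rw [abs_lt]; have := Real.pi_gt_three
    constructor <;> linarith [ha.1, ha.2, hb.1, hb.2]
  refine hinf.mono ?_
  rintro _ ⟨φ, _, rfl⟩
  exact h φ

/-- The real function `f` satisfies `f(φ) e^{imφ/2} = p(e^{iφ})` with `p` of degree at most `m`:
it is a real trigonometric polynomial of degree at most `m / 2`. -/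
structure TrigRep (m : ℕ) (f : ℝ → ℝ) (p : ℂ[X]) : Prop where
  natDegree_le : p.natDegree ≤ m
  eval_cis : ∀ φ : ℝ, (f φ : ℂ) * cis (m * φ / 2) = p.eval (cis φ)

namespace TrigRep

variable {m k : ℕ} {f g : ℝ → ℝ} {p q : ℂ[X]}

theorem unique (h : TrigRep m f p) (h' : TrigRep m f q) : p = q :=
  poly_eq_of_eval_cis fun φ => by rw [← h.eval_cis, h'.eval_cis]

theorem eq_mul_cis (h : TrigRep m f p) (φ : ℝ) : (f φ : ℂ) = p.eval (cis φ) * cis (-(m * φ / 2)) := by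
  rw [← h.eval_cis, mul_assoc, ← cis_add]; simp [cis_zero]

theorem congr_fun (h : TrigRep m f p) (h' : TrigRep m g p) : f = g := by
  funext φ
  have := (h.eq_mul_cis φ).trans (h'.eq_mul_cis φ).symm
  exact_mod_cast this

theorem zero_iff (h : TrigRep m f p) (φ : ℝ) : f φ = 0 ↔ p.eval (cis φ) = 0 := by
  rw [← h.eval_cis]; simp [cis_ne_zero]

theorem add (h : TrigRep m f p) (h' : TrigRep m g q) :
    TrigRep m (fun φ => f φ + g φ) (p + q) := by
  refine ⟨(natDegree_add_le _ _).trans (max_le h.1 h'.1), fun φ => ?_⟩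
  rw [eval_add, ← h.eval_cis, ← h'.eval_cis]; push_cast; ring

theorem smul (h : TrigRep m f p) (r : ℝ) : TrigRep m (fun φ => r * f φ) (C (r : ℂ) * p) := by
  refine ⟨(natDegree_C_mul_le _ _).trans h.1, fun φ => ?_⟩
  rw [eval_mul, ← h.eval_cis, eval_C]; push_cast; ring

theorem neg (h : TrigRep m f p) : TrigRep m (fun φ => -f φ) (-p) := by
  have := h.smul (-1)
  simpa using this

theorem sub (h : TrigRep m f p) (h' : TrigRep m g q) :
    TrigRep m (fun φ => f φ - g φ) (p - q) := by
  simpa [sub_eq_add_neg] using h.add h'.neg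

theorem mul (h : TrigRep m f p) (h' : TrigRep k g q) :
    TrigRep (m + k) (fun φ => f φ * g φ) (p * q) := by
  refine ⟨natDegree_mul_le.trans (add_le_add h.1 h'.1), fun φ => ?_⟩
  rw [eval_mul, ← h.eval_cis, ← h'.eval_cis]
  have : ((m + k : ℕ) : ℝ) * φ / 2 = m * φ / 2 + k * φ / 2 := by push_cast; ring
  rw [this, cis_add]; push_cast; ring

theorem one : TrigRep 2 (fun _ => 1) X := by
  refine ⟨natDegree_X_le.trans (by norm_num), fun φ => ?_⟩
  simp

theorem const (r : ℝ) : TrigRep 0 (fun _ => r) (C (r : ℂ)) := by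
  refine ⟨by simp, fun φ => ?_⟩
  simp [cis_zero]

theorem raise (h : TrigRep m f p) : TrigRep (m + 2) f (p * X) := by
  simpa using h.mul one

theorem cos : TrigRep 2 Real.cos (C (1 / 2) * (X ^ 2 + 1)) := by
  refine ⟨?_, fun φ => ?_⟩
  · compute_degree
  · have h : cis φ * cis (-φ) = 1 := by rw [← cis_add]; simp [cis_zero]
    have h2 : (Real.cos φ : ℂ) = (cis φ + cis (-φ)) / 2 := by
      rw [cis_eq, cis_eq]; simp; ring
    have h3 : ((2 : ℕ) : ℝ) * φ / 2 = φ := by push_cast; ring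
    rw [h3, h2]
    simp only [eval_mul, eval_C, eval_add, eval_pow, eval_X, eval_one]
    linear_combination h / 2

theorem sin : TrigRep 2 Real.sin (C (-Complex.I / 2) * (X ^ 2 - 1)) := by
  refine ⟨?_, fun φ => ?_⟩
  · compute_degree
  · have h : cis φ * cis (-φ) = 1 := by rw [← cis_add]; simp [cis_zero]
    have h2 : (Real.sin φ : ℂ) = (cis φ - cis (-φ)) * (-Complex.I / 2) := by
      rw [cis_eq, cis_eq]; simp; ring_nf; simp
    have h3 : ((2 : ℕ) : ℝ) * φ / 2 = φ := by push_cast; ring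
    rw [h3, h2]
    simp only [eval_mul, eval_C, eval_sub, eval_pow, eval_X, eval_one]
    linear_combination h * (Complex.I / 2)

theorem sin_half_sub (ψ : ℝ) : TrigRep 1 (fun φ => Real.sin ((φ - ψ) / 2))
    (C (-Complex.I / 2 * cis (-ψ / 2)) * (X - C (cis ψ))) := by
  refine ⟨?_, fun φ => ?_⟩
  · compute_degree
  · have h2 : (Real.sin ((φ - ψ) / 2) : ℂ) =
        (cis ((φ - ψ) / 2) - cis (-((φ - ψ) / 2))) * (-Complex.I / 2) := by
      rw [cis_eq, cis_eq]; simp; ring_nf; simp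
    have e1 : cis ((φ - ψ) / 2) * cis (((1 : ℕ) : ℝ) * φ / 2) = cis (-ψ / 2) * cis φ := by
      rw [← cis_add, ← cis_add]; congr 1; push_cast; ring
    have e2 : cis (-((φ - ψ) / 2)) * cis (((1 : ℕ) : ℝ) * φ / 2) = cis (-ψ / 2) * cis ψ := by
      rw [← cis_add, ← cis_add]; congr 1; push_cast; ring
    rw [h2]
    simp only [eval_mul, eval_C, eval_sub, eval_X]
    linear_combination (-Complex.I / 2) * (e1 - e2)

theorem prod_sin_half {ι : Type*} (s : Finset ι) (x : ι → ℝ) :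
    TrigRep s.card (fun φ => ∏ i ∈ s, Real.sin ((φ - x i) / 2))
      (C (∏ i ∈ s, (-Complex.I / 2 * cis (-x i / 2))) * ∏ i ∈ s, (X - C (cis (x i)))) := by
  classical
  induction s using Finset.induction_on with
  | empty => simpa using const 1
  | insert a s ha ih =>
    have := ih.mul (sin_half_sub (x a))
    rw [Finset.card_insert_of_notMem ha]
    convert this using 1
    · funext φ; rw [Finset.prod_insert ha, mul_comm]
    · rw [Finset.prod_insert ha, Finset.prod_insert ha, C_mul]; ring

theorem eval_reflect_cis (hp : p.natDegree ≤ m) (φ : ℝ) :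
    (p.reflect m).eval (cis φ) = cis (m * φ) * p.eval (cis (-φ)) := by
  let _ : Invertible (cis (-φ)) := invertibleOfNonzero (cis_ne_zero _)
  have h := eval₂_reflect_mul_pow (RingHom.id ℂ) (cis (-φ)) m p hp
  simp only [invOf_eq_inv, ← cis_neg, neg_neg, cis_pow, eval₂_id] at h
  rw [← h]
  have : cis (m * φ) * cis (m * -φ) = 1 := by rw [← cis_add]; simp [cis_zero]
  linear_combination -(p.reflect m).eval (cis φ) * this

theorem comp_neg (h : TrigRep m f p) : TrigRep m (fun φ => f (-φ)) (p.reflect m) := by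
  refine ⟨(natDegree_reflect_le).trans (by simp [h.1]), fun φ => ?_⟩
  rw [eval_reflect_cis h.1, ← h.eval_cis]
  have : cis (m * φ / 2) = cis (m * φ) * cis (m * -φ / 2) := by
    rw [← cis_add]; congr 1; ring
  rw [this]; ring

theorem conj_eval_cis (p : ℂ[X]) (φ : ℝ) :
    (starRingEnd ℂ) (p.eval (cis φ)) = (p.map (starRingEnd ℂ)).eval (cis (-φ)) := by
  rw [← conj_cis, eval_map_apply]

theorem comp_neg' (h : TrigRep m f p) : TrigRep m (fun φ => f (-φ)) (p.map (starRingEnd ℂ)) := by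
  refine ⟨natDegree_map_le.trans h.1, fun φ => ?_⟩
  have h1 := conj_eval_cis p (-φ)
  rw [neg_neg] at h1
  rw [← h1, ← h.eval_cis, map_mul, conj_cis, Complex.conj_ofReal]
  congr 2; ring

/-- The function f(-φ) is represented both by reversing the coefficients (z ↦ 1/z) and by
conjugating them (f is real). Thus f being real amounts to p being self-reciprocal; `of_reflect_eq`
is the converse. -/
theorem reflect_eq (h : TrigRep m f p) : p.reflect m = p.map (starRingEnd ℂ) :=
  h.comp_neg.unique h.comp_neg'

theorem coeff_zero (h : TrigRep m f p) : p.coeff 0 = (starRingEnd ℂ) (p.coeff m) := by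
  have := congrArg (fun r => r.coeff m) h.reflect_eq
  simpa [coeff_reflect, revAt_le] using this

theorem of_reflect_eq (hp : p.natDegree ≤ m) (h : p.reflect m = p.map (starRingEnd ℂ)) :
    TrigRep m (fun φ => (p.eval (cis φ) * cis (-(m * φ / 2))).re) p := by
  refine ⟨hp, fun φ => ?_⟩
  have h1 : (starRingEnd ℂ) (p.eval (cis φ) * cis (-(m * φ / 2))) =
      p.eval (cis φ) * cis (-(m * φ / 2)) := by
    rw [map_mul, conj_eval_cis, ← h, eval_reflect_cis hp, conj_cis, neg_neg, neg_neg]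
    have : cis (m * -φ) * cis (m * φ / 2) = cis (-(m * φ / 2)) := by
      rw [← cis_add]; congr 1; ring
    rw [← this]; ring
  rw [Complex.conj_eq_iff_re.1 h1, mul_assoc, ← cis_add]
  simp [cis_zero]

theorem continuous (h : TrigRep m f p) : Continuous f := by
  have : f = fun φ => (p.eval (cis φ) * cis (-(m * φ / 2))).re := by
    funext φ; rw [← h.eq_mul_cis]; simp
  rw [this]
  have := continuous_cis
  fun_prop

theorem eq_zero_of_poly (h : TrigRep m f 0) (φ : ℝ) : f φ = 0 := by
  rw [h.zero_iff]; simp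

/-- A trigonometric polynomial of level `m` with more than `m` zeros in a period vanishes. -/
theorem eq_zero_of_zeros (h : TrigRep m f p) (s : Finset ℝ) (hs : m < s.card)
    (hd : ∀ x ∈ s, ∀ y ∈ s, |x - y| < 2 * Real.pi) (hz : ∀ x ∈ s, f x = 0) : p = 0 := by
  classical
  refine eq_zero_of_natDegree_lt_card_of_eval_eq_zero' p (s.image cis) ?_ ?_
  · intro z hz'
    obtain ⟨x, hx, rfl⟩ := Finset.mem_image.1 hz'
    exact (h.zero_iff x).1 (hz x hx)
  · rw [Finset.card_image_of_injOn]
    · exact h.1.trans_lt hs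
    · intro x hx y hy hxy
      exact cis_injective_of_abs_lt (hd x hx y hy) hxy

/-- The derivative of a trigonometric polynomial. -/
theorem hasDerivAt (h : TrigRep m f p) : ∃ f' : ℝ → ℝ,
    TrigRep m f' (C Complex.I * (X * derivative p - C (m / 2 : ℂ) * p)) ∧
      ∀ φ, HasDerivAt f (f' φ) φ := by
  set p' : ℂ[X] := C Complex.I * (X * derivative p - C (m / 2 : ℂ) * p) with hp'
  have hder : ∀ φ : ℝ, HasDerivAt (fun x : ℝ => (f x : ℂ))
      (p'.eval (cis φ) * cis (-(m * φ / 2))) φ := by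
    intro φ
    have e : (fun x : ℝ => (f x : ℂ)) = fun x => p.eval (cis x) * cis (-(m * x / 2)) := by
      funext x; exact h.eq_mul_cis x
    rw [e]
    have h1 : HasDerivAt (fun x => p.eval (cis x)) (Complex.I * cis φ * (derivative p).eval (cis φ)) φ := by
      have := (p.hasDerivAt (cis φ)).scomp φ (hasDerivAt_cis φ)
      simpa [smul_eq_mul, Function.comp_def] using this
    have h2 : HasDerivAt (fun x : ℝ => cis (-(m * x / 2)))
        (Complex.I * cis (-(m * φ / 2)) * (-(m / 2 : ℝ) : ℝ)) φ := by
      have h3 : HasDerivAt (fun x : ℝ => -(m * x / 2)) (-(m / 2 : ℝ)) φ := by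
        have := (hasDerivAt_id φ).const_mul (-(m / 2 : ℝ))
        rw [mul_one] at this
        refine this.congr_of_eventuallyEq (Filter.Eventually.of_forall fun x => ?_)
        simp only [id]; ring
      have := (hasDerivAt_cis (-(m * φ / 2))).scomp φ h3
      simpa [smul_eq_mul, Function.comp_def, mul_comm] using this
    refine (h1.mul h2).congr_deriv ?_
    simp only [hp', eval_mul, eval_C, eval_sub, eval_X]
    push_cast; ring
  have him : ∀ φ : ℝ, (p'.eval (cis φ) * cis (-(m * φ / 2))).im = 0 := by
    intro φ
    have h1 := (Complex.imCLM.hasFDerivAt.comp_hasDerivAt φ (hder φ))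
    have h2 : HasDerivAt (fun _ : ℝ => (0 : ℝ)) 0 φ := hasDerivAt_const _ _
    refine HasDerivAt.unique h1 (h2.congr_of_eventuallyEq (Filter.Eventually.of_forall fun x => ?_))
    simp
  refine ⟨fun φ => (p'.eval (cis φ) * cis (-(m * φ / 2))).re, ⟨?_, ?_⟩, ?_⟩
  · refine (natDegree_C_mul_le _ _).trans ((natDegree_sub_le _ _).trans (max_le ?_ ?_))
    · by_cases h0 : p.natDegree = 0
      · have : derivative p = 0 := by
          rw [eq_C_of_natDegree_eq_zero h0]; simp
        simp [this]
      · refine natDegree_mul_le.trans ?_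
        have := natDegree_derivative_lt h0
        have := h.1
        simp only [natDegree_X]; omega
    · exact (natDegree_C_mul_le _ _).trans h.1
  · intro φ
    have : (((p'.eval (cis φ) * cis (-(m * φ / 2))).re : ℝ) : ℂ) =
        p'.eval (cis φ) * cis (-(m * φ / 2)) := by
      apply Complex.ext <;> simp [him φ]
    rw [this, mul_assoc, ← cis_add]; simp [cis_zero]
  · intro φ
    have h1 := (Complex.reCLM.hasFDerivAt.comp_hasDerivAt φ (hder φ))
    exact h1

/-- A trigonometric polynomial whose leading coefficient vanishes has lower level. -/
theorem lower (h : TrigRep (m + 2) f p) (h0 : p.coeff (m + 2) = 0) : ∃ q, TrigRep m f q := by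
  -- The bottom coefficient is conjugate to the top one, so both ends drop together and X divides p.
  have hc0 : p.coeff 0 = 0 := by rw [h.coeff_zero, h0, map_zero]
  obtain ⟨q, rfl⟩ := X_dvd_iff.2 hc0
  refine ⟨q, ⟨?_, fun φ => ?_⟩⟩
  · rw [natDegree_le_iff_coeff_eq_zero]
    intro N hN
    have : (X * q).coeff (N + 1) = q.coeff N := by rw [mul_comm, coeff_mul_X]
    rw [← this]
    rcases Nat.lt_or_ge (m + 2) (N + 1) with h1 | h1
    · exact coeff_eq_zero_of_natDegree_lt (h.1.trans_lt h1)
    · have : N + 1 = m + 2 := by omega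
      rw [this, h0]
  · have h1 := h.eval_cis φ
    have h2 : ((m + 2 : ℕ) : ℝ) * φ / 2 = m * φ / 2 + φ := by push_cast; ring
    rw [h2, cis_add, eval_mul, eval_X] at h1
    have := cis_ne_zero φ
    apply mul_left_cancel₀ this
    linear_combination h1

theorem periodic {n : ℕ} (h : TrigRep (2 * n) f p) : Function.Periodic f (2 * Real.pi) := by
  intro φ
  have h1 := h.eq_mul_cis (φ + 2 * Real.pi)
  have h2 := h.eq_mul_cis φ
  have e1 : cis (φ + 2 * Real.pi) = cis φ := by rw [cis_add, cis_two_pi, mul_one]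
  have e2 : cis (-(((2 * n : ℕ) : ℝ) * (φ + 2 * Real.pi) / 2)) = cis (-(((2 * n : ℕ) : ℝ) * φ / 2)) := by
    have : -(((2 * n : ℕ) : ℝ) * (φ + 2 * Real.pi) / 2) =
      -(((2 * n : ℕ) : ℝ) * φ / 2) + -(n * (2 * Real.pi)) := by push_cast; ring
    rw [this, cis_add, cis_neg (n * _), cis_nat_mul, cis_two_pi]; simp
  rw [e1, e2, ← h2] at h1
  exact_mod_cast h1

end TrigRep

/-! ### Divided differences and sign alternation. -/

theorem cis_sub_cis (a b : ℝ) :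
    cis a - cis b = 2 * Complex.I * cis ((a + b) / 2) * Real.sin ((a - b) / 2) := by
  have h2 : (Real.sin ((a - b) / 2) : ℂ) =
      (cis ((a - b) / 2) - cis (-((a - b) / 2))) * (-Complex.I / 2) := by
    rw [cis_eq, cis_eq]; simp; ring_nf; simp
  have e1 : cis ((a + b) / 2) * cis ((a - b) / 2) = cis a := by
    rw [← cis_add]; congr 1; ring
  have e2 : cis ((a + b) / 2) * cis (-((a - b) / 2)) = cis b := by
    rw [← cis_add]; congr 1; ring
  rw [h2, ← e1, ← e2]
  linear_combination (cis ((a + b) / 2) * cis ((a - b) / 2) -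
    cis ((a + b) / 2) * cis (-((a - b) / 2))) * Complex.I_sq

theorem cis_sum {ι : Type*} (s : Finset ι) (x : ι → ℝ) :
    cis (∑ i ∈ s, x i) = ∏ i ∈ s, cis (x i) := by
  classical
  induction s using Finset.induction_on with
  | empty => simp [cis_zero]
  | insert a s ha ih => rw [Finset.sum_insert ha, Finset.prod_insert ha, cis_add, ih]

/-- The sign of a product of half-angle sines at increasing nodes. -/
theorem sign_prod_sin_half {N : ℕ} {x : Fin N → ℝ} (hx : StrictMono x)
    (hper : ∀ i j, x j - x i < 2 * Real.pi) (j : Fin N) :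
    0 < (-1 : ℝ) ^ (N - 1 - j : ℕ) * ∏ i ∈ Finset.univ.erase j, Real.sin ((x j - x i) / 2) := by
  have h1 : ∏ i ∈ Finset.univ.erase j, Real.sin ((x j - x i) / 2) =
      (∏ i ∈ Finset.univ.erase j, if j < i then (-1 : ℝ) else 1) *
        ∏ i ∈ Finset.univ.erase j, |Real.sin ((x j - x i) / 2)| := by
    rw [← Finset.prod_mul_distrib]
    refine Finset.prod_congr rfl fun i hi => ?_
    have hij : i ≠ j := Finset.ne_of_mem_erase hi
    split_ifs with h
    · have : Real.sin ((x j - x i) / 2) < 0 := by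
        have h2 := hx h
        have h3 := hper j i
        apply Real.sin_neg_of_neg_of_neg_pi_lt <;> linarith
      rw [abs_of_neg this]; ring
    · have : 0 < Real.sin ((x j - x i) / 2) := by
        have h2 := hx (lt_of_le_of_ne (not_lt.1 h) hij)
        have h3 := hper i j
        apply Real.sin_pos_of_pos_of_lt_pi <;> linarith
      rw [abs_of_pos this]; ring
  have h2 : (∏ i ∈ Finset.univ.erase j, if j < i then (-1 : ℝ) else 1) = (-1) ^ (N - 1 - j : ℕ) := by
    rw [Finset.prod_ite]
    simp only [Finset.prod_const, one_pow, mul_one]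
    congr 1
    rw [← Fin.card_Ioi]
    congr 1
    ext i
    simp only [Finset.mem_filter, Finset.mem_erase, Finset.mem_univ, and_true, Finset.mem_Ioi]
    exact ⟨fun h => h.2, fun h => ⟨h.ne', h⟩⟩
  have h3 : 0 < ∏ i ∈ Finset.univ.erase j, |Real.sin ((x j - x i) / 2)| := by
    refine Finset.prod_pos fun i hi => abs_pos.2 ?_
    have hij : i ≠ j := Finset.ne_of_mem_erase hi
    rcases lt_or_gt_of_ne hij with h | h
    · have h2 := hx h
      have h3 := hper i j
      exact (Real.sin_pos_of_pos_of_lt_pi (by linarith) (by linarith)).ne'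
    · have h2 := hx h
      have h3 := hper j i
      exact (Real.sin_neg_of_neg_of_neg_pi_lt (by linarith) (by linarith)).ne
  rw [h1, h2, ← mul_assoc, ← mul_pow]
  simpa using h3

namespace TrigRep

variable {m : ℕ} {f : ℝ → ℝ} {p : ℂ[X]}

/-- The divided difference at `m + 2` nodes annihilates trigonometric polynomials of level `m`. -/
theorem sum_div_prod_sin (h : TrigRep m f p) {x : Fin (m + 2) → ℝ} (hx : StrictMono x)
    (hper : ∀ i j, x j - x i < 2 * Real.pi) :
    ∑ j, f (x j) / ∏ i ∈ Finset.univ.erase j, Real.sin ((x j - x i) / 2) = 0 := by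
  have hinj : Set.InjOn (fun j => cis (x j)) (Finset.univ : Finset (Fin (m + 2))) := by
    intro i _ j _ hij
    refine hx.injective (cis_injective_of_abs_lt ?_ hij)
    rw [abs_lt]; constructor <;> linarith [hper i j, hper j i]
  have hdeg : p.degree < (Finset.univ : Finset (Fin (m + 2))).card := by
    refine degree_le_natDegree.trans_lt ?_
    rw [Finset.card_univ, Fintype.card_fin]
    have := h.1
    exact_mod_cast (by omega : p.natDegree < m + 2)
  -- The interpolation formula for the coefficient of degree m + 1, which vanishes because p has
  -- degree at most m.
  have key := Lagrange.coeff_eq_sum hinj hdeg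
  rw [Finset.card_univ, Fintype.card_fin, coeff_eq_zero_of_natDegree_lt (by have := h.1; omega)]
    at key
  -- The phase common to all node products. Each product has one further phase, `cis (m * x j / 2)`,
  -- which is exactly the one relating f to p.
  set c : ℂ := (2 * Complex.I) ^ (m + 1) * cis ((∑ i, x i) / 2) with hc
  have hc0 : c ≠ 0 := by
    simp [hc, cis_ne_zero, Complex.I_ne_zero]
  have hterm : ∀ j, p.eval (cis (x j)) / ∏ i ∈ Finset.univ.erase j, (cis (x j) - cis (x i)) =
      ((f (x j) / ∏ i ∈ Finset.univ.erase j, Real.sin ((x j - x i) / 2) : ℝ) : ℂ) / c := by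
    intro j
    have e1 : ∏ i ∈ Finset.univ.erase j, (cis (x j) - cis (x i)) =
        c * cis (m * x j / 2) *
          ((∏ i ∈ Finset.univ.erase j, Real.sin ((x j - x i) / 2) : ℝ) : ℂ) := by
      simp_rw [cis_sub_cis]
      rw [Finset.prod_mul_distrib, Finset.prod_mul_distrib, Finset.prod_const,
        Finset.card_erase_of_mem (Finset.mem_univ j), Finset.card_univ, Fintype.card_fin, ← cis_sum]
      have e2 : ∑ i ∈ Finset.univ.erase j, (x j + x i) / 2 = (∑ i, x i) / 2 + m * x j / 2 := by
        rw [← Finset.sum_div, Finset.sum_add_distrib, Finset.sum_const,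
          Finset.card_erase_of_mem (Finset.mem_univ j), Finset.card_univ, Fintype.card_fin,
          ← Finset.add_sum_erase _ _ (Finset.mem_univ j)]
        simp; ring
      rw [e2, cis_add, hc]
      simp only [show m + 2 - 1 = m + 1 from rfl]
      push_cast; ring
    rw [e1, ← h.eval_cis]
    push_cast
    have := cis_ne_zero (m * x j / 2)
    rw [div_div, mul_comm c, mul_assoc, mul_comm (f (x j) : ℂ), mul_div_mul_left _ _ this, mul_comm c]
  have : ∑ j, p.eval (cis (x j)) / ∏ i ∈ Finset.univ.erase j, (cis (x j) - cis (x i)) =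
      ((∑ j, f (x j) / ∏ i ∈ Finset.univ.erase j, Real.sin ((x j - x i) / 2) : ℝ) : ℂ) / c := by
    rw [Finset.sum_congr rfl fun j _ => hterm j, ← Finset.sum_div]
    push_cast; rfl
  rw [this] at key
  have := (div_eq_zero_iff.1 key.symm).resolve_right hc0
  exact_mod_cast this

/-- A trigonometric polynomial of level `m` with weakly alternating signs at `m + 2` points of a
period vanishes. -/
theorem eq_zero_of_alternating (h : TrigRep m f p) {x : Fin (m + 2) → ℝ} (hx : StrictMono x)
    (hper : ∀ i j, x j - x i < 2 * Real.pi) {ε : ℝ} (hε : ε ≠ 0)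
    (hs : ∀ j : Fin (m + 2), 0 ≤ ε * (-1) ^ (j : ℕ) * f (x j)) : p = 0 := by
  classical
  have key := h.sum_div_prod_sin hx hper
  have key2 : ∑ j, ε * (-1) ^ (m + 1) *
      (f (x j) / ∏ i ∈ Finset.univ.erase j, Real.sin ((x j - x i) / 2)) = 0 := by
    rw [← Finset.mul_sum, key, mul_zero]
  -- The node products alternate in sign just as the values of f do. All terms of the vanishing sum
  -- therefore have one sign, each is zero, and m + 2 zeros are too many.
  have hnn : ∀ j ∈ Finset.univ, 0 ≤ ε * (-1) ^ (m + 1) *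
      (f (x j) / ∏ i ∈ Finset.univ.erase j, Real.sin ((x j - x i) / 2)) := by
    intro j _
    have h1 := sign_prod_sin_half hx hper j
    set P := ∏ i ∈ Finset.univ.erase j, Real.sin ((x j - x i) / 2)
    have e : ε * (-1) ^ (m + 1) * (f (x j) / P) =
        (ε * (-1) ^ (j : ℕ) * f (x j)) / ((-1) ^ (m + 2 - 1 - j : ℕ) * P) := by
      have hj : m + 1 = (m + 2 - 1 - j) + j := by omega
      have h3 : ((-1 : ℝ) ^ (m + 2 - 1 - j : ℕ)) * (-1) ^ (m + 2 - 1 - j : ℕ) = 1 := by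
        rw [← mul_pow]; simp
      have h4 : P ≠ 0 := fun h0 => by rw [h0, mul_zero] at h1; exact lt_irrefl _ h1
      have h5 : ((-1 : ℝ) ^ (m + 2 - 1 - j : ℕ)) ≠ 0 := by positivity
      rw [show ((-1 : ℝ) ^ (m + 1)) = (-1) ^ (m + 2 - 1 - j : ℕ) * (-1) ^ (j : ℕ) by
        rw [← pow_add, ← hj]]
      have h6 : f (x j) / P * P = f (x j) := div_mul_cancel₀ _ h4
      rw [eq_div_iff (mul_ne_zero h5 h4)]
      generalize f (x j) / P = y at *
      rw [← h6]
      linear_combination (ε * (-1) ^ (j : ℕ) * y * P) * h3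
    rw [e]
    exact div_nonneg (hs j) h1.le
  have hz := (Finset.sum_eq_zero_iff_of_nonneg hnn).1 key2
  refine h.eq_zero_of_zeros (Finset.univ.image x) ?_ ?_ ?_
  · rw [Finset.card_image_of_injective _ hx.injective, Finset.card_univ, Fintype.card_fin]; omega
  · simp only [Finset.mem_image, Finset.mem_univ, true_and, forall_exists_index,
      forall_apply_eq_imp_iff]
    intro i j
    rw [abs_lt]; constructor <;> linarith [hper i j, hper j i]
  · simp only [Finset.mem_image, Finset.mem_univ, true_and, forall_exists_index,
      forall_apply_eq_imp_iff]
    intro j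
    have h1 := hz j (Finset.mem_univ _)
    have h2 := sign_prod_sin_half hx hper j
    have h4 : ∏ i ∈ Finset.univ.erase j, Real.sin ((x j - x i) / 2) ≠ 0 :=
      fun h0 => by rw [h0, mul_zero] at h2; exact lt_irrefl _ h2
    simpa [hε, h4] using h1

end TrigRep

/-! ### The weight. -/

/-- The modulus of `(z - 1)^{2a} (z + 1)^{2b}` at `z = e^{iφ}`. -/
noncomputable def jacobiWeight (a b φ : ℝ) : ℝ :=
  (2 - 2 * Real.cos φ) ^ a * (2 + 2 * Real.cos φ) ^ b

section weight

variable {a b : ℝ}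

theorem jacobiWeight_neg (φ : ℝ) : jacobiWeight a b (-φ) = jacobiWeight a b φ := by
  simp [jacobiWeight]

theorem jacobiWeight_periodic : Function.Periodic (jacobiWeight a b) (2 * Real.pi) := by
  intro φ; simp [jacobiWeight]

theorem jacobiWeight_nonneg (φ : ℝ) : 0 ≤ jacobiWeight a b φ := by
  have h1 := Real.cos_le_one φ
  have h2 := Real.neg_one_le_cos φ
  exact mul_nonneg (Real.rpow_nonneg (by linarith) _) (Real.rpow_nonneg (by linarith) _)

theorem abs_cos_lt_one {φ : ℝ} (h : Real.sin φ ≠ 0) : -1 < Real.cos φ ∧ Real.cos φ < 1 := by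
  have h1 := Real.sin_sq_add_cos_sq φ
  have h2 : 0 < Real.sin φ ^ 2 := by positivity
  constructor <;> nlinarith

theorem jacobiWeight_pos {φ : ℝ} (h : Real.sin φ ≠ 0) : 0 < jacobiWeight a b φ := by
  obtain ⟨h1, h2⟩ := abs_cos_lt_one h
  exact mul_pos (Real.rpow_pos_of_pos (by linarith) _) (Real.rpow_pos_of_pos (by linarith) _)

theorem jacobiWeight_eq_zero (ha : 0 < a) (hb : 0 < b) {φ : ℝ} (h : Real.sin φ = 0) :
    jacobiWeight a b φ = 0 := by
  have h1 := Real.sin_sq_add_cos_sq φ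
  rw [h] at h1
  have h2 : (Real.cos φ - 1) * (Real.cos φ + 1) = 0 := by linear_combination h1
  rcases mul_eq_zero.1 h2 with h3 | h3
  · have : Real.cos φ = 1 := by linarith
    simp [jacobiWeight, this, Real.zero_rpow ha.ne']
  · have : Real.cos φ = -1 := by linarith
    simp [jacobiWeight, this, Real.zero_rpow hb.ne']

theorem continuous_jacobiWeight (ha : 0 < a) (hb : 0 < b) : Continuous (jacobiWeight a b) := by
  unfold jacobiWeight
  refine Continuous.mul ?_ ?_
  · exact Continuous.rpow_const (by fun_prop) fun _ => Or.inr ha.le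
  · exact Continuous.rpow_const (by fun_prop) fun _ => Or.inr hb.le

/-- The logarithmic derivative is a·cot(φ/2) - b·tan(φ/2), put over the common denominator sin φ. -/
theorem hasDerivAt_jacobiWeight {φ : ℝ} (h : Real.sin φ ≠ 0) :
    HasDerivAt (jacobiWeight a b)
      (jacobiWeight a b φ * ((a + b) * Real.cos φ + (a - b)) / Real.sin φ) φ := by
  obtain ⟨h1, h2⟩ := abs_cos_lt_one h
  have hA : 0 < 2 - 2 * Real.cos φ := by linarith
  have hB : 0 < 2 + 2 * Real.cos φ := by linarith
  have d1 : HasDerivAt (fun x => 2 - 2 * Real.cos x) (2 * Real.sin φ) φ := by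
    refine (((Real.hasDerivAt_cos φ).const_mul 2).const_sub 2).congr_deriv (by ring)
  have d2 : HasDerivAt (fun x => 2 + 2 * Real.cos x) (-(2 * Real.sin φ)) φ := by
    refine (((Real.hasDerivAt_cos φ).const_mul 2).const_add 2).congr_deriv (by ring)
  have e1 := d1.rpow_const (p := a) (Or.inl hA.ne')
  have e2 := d2.rpow_const (p := b) (Or.inl hB.ne')
  refine (e1.mul e2).congr_deriv ?_
  rw [Real.rpow_sub_one hA.ne', Real.rpow_sub_one hB.ne']
  have hs := Real.sin_sq_add_cos_sq φ
  unfold jacobiWeight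
  generalize (2 - 2 * Real.cos φ) ^ a = u
  generalize (2 + 2 * Real.cos φ) ^ b = v
  have hA' : 1 - Real.cos φ ≠ 0 := (by linarith : 0 < 1 - Real.cos φ).ne'
  have hB' : 1 + Real.cos φ ≠ 0 := (by linarith : 0 < 1 + Real.cos φ).ne'
  have hA2 : 2 - 2 * Real.cos φ = 2 * (1 - Real.cos φ) := by ring
  have hB2 : 2 + 2 * Real.cos φ = 2 * (1 + Real.cos φ) := by ring
  rw [hA2, hB2]
  field_simp
  have hs' : Real.sin φ ^ 2 = 1 - Real.cos φ ^ 2 := by linarith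
  rw [hs']
  ring

end weight

/-! ### Existence of extremal trigonometric polynomials. -/

/-- The real vector space of polynomials representing real trigonometric polynomials. -/
noncomputable def trigSubspace (m : ℕ) : Submodule ℝ ℂ[X] where
  carrier := {p | ∃ f, TrigRep m f p}
  add_mem' := by rintro p q ⟨f, hf⟩ ⟨g, hg⟩; exact ⟨_, hf.add hg⟩
  zero_mem' := ⟨fun _ => 0, by simp, by simp⟩
  smul_mem' := by
    rintro r p ⟨f, hf⟩
    have := hf.smul r
    rw [← smul_eq_C_mul, Complex.coe_smul] at this
    exact ⟨_, this⟩

theorem finiteDimensional_trigSubspace (m : ℕ) : FiniteDimensional ℝ (trigSubspace m) := by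
  let L : trigSubspace m →ₗ[ℝ] (Fin (m + 1) → ℂ) :=
    { toFun := fun p i => (p : ℂ[X]).coeff i
      map_add' := fun p q => by ext i; simp
      map_smul' := fun r p => by ext i; simp }
  refine FiniteDimensional.of_injective L ?_
  intro p q h
  obtain ⟨f, hf⟩ := p.2
  obtain ⟨g, hg⟩ := q.2
  ext i : 2
  rcases Nat.lt_or_ge m i with h1 | h1
  · rw [coeff_eq_zero_of_natDegree_lt (hf.1.trans_lt h1),
      coeff_eq_zero_of_natDegree_lt (hg.1.trans_lt h1)]
  · exact congrFun h ⟨i, by omega⟩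

/-- `f`, represented by `p`, minimizes the weighted sup norm `M` among real trigonometric
polynomials of degree at most `n` whose leading coefficient lies in `Λ`. -/
structure IsExtremal (a b : ℝ) (n : ℕ) (Λ : Set ℂ) (f : ℝ → ℝ) (p : ℂ[X]) (M : ℝ) : Prop where
  rep : TrigRep (2 * n) f p
  lead : p.coeff (2 * n) ∈ Λ
  pos : 0 < M
  bound : ∀ φ, |jacobiWeight a b φ * f φ| ≤ M
  le : ∀ g q M', TrigRep (2 * n) g q → q.coeff (2 * n) ∈ Λ →
    (∀ φ, |jacobiWeight a b φ * g φ| ≤ M') → M ≤ M'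

/-- A periodic property that holds on one period holds everywhere. -/
theorem forall_of_periodic {P : ℝ → Prop} (hP : ∀ φ, P (φ + 2 * Real.pi) ↔ P φ)
    (h : ∀ φ ∈ Set.Icc (-Real.pi) Real.pi, P φ) (φ : ℝ) : P φ := by
  have hper : Function.Periodic (fun x => P (x - Real.pi)) (2 * Real.pi) := fun x => by
    have := hP (x - Real.pi)
    simp only
    rw [← this]; congr 1; ring
  obtain ⟨z, hz, hzx⟩ := hper.exists_mem_Ico₀ (by positivity) (φ + Real.pi)
  simp only [add_sub_cancel_right] at hzx
  rw [hzx]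
  exact h _ ⟨by linarith [hz.1], by linarith [hz.2]⟩

/-- The weighted sup norm makes `trigSubspace (2 * n)` a finite-dimensional normed space, where a
nonempty closed set has a point nearest to 0. Since 0 is not in Λ, this point is nonzero and M > 0.
-/
theorem TrigRep.exists_isExtremal {a b : ℝ} (ha : 0 < a) (hb : 0 < b) (n : ℕ) {Λ : Set ℂ}
    (hΛ : IsClosed Λ) (h0 : (0 : ℂ) ∉ Λ) {f₀ : ℝ → ℝ} {p₀ : ℂ[X]} (hf₀ : TrigRep (2 * n) f₀ p₀)
    (hp₀ : p₀.coeff (2 * n) ∈ Λ) : ∃ f p M, IsExtremal a b n Λ f p M := by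
  classical
  let K := Set.Icc (-Real.pi) Real.pi
  have : CompactSpace K := isCompact_iff_compactSpace.1 isCompact_Icc
  -- The real part gives a formula for f that is real-linear in p and needs no choice of f.
  let ev : ℝ → ℂ[X] → ℝ := fun φ p => (p.eval (cis φ) * cis (-((2 * n : ℕ) * φ / 2))).re
  have hev : ∀ f p, TrigRep (2 * n) f p → ∀ φ, ev φ p = f φ := by
    intro f p hf φ
    simp only [ev]
    rw [← hf.eq_mul_cis, Complex.ofReal_re]
  let Φ : trigSubspace (2 * n) →ₗ[ℝ] C(K, ℝ) :=
    { toFun := fun p => ⟨fun φ => jacobiWeight a b φ * ev φ p, by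
        have h1 := continuous_jacobiWeight ha hb
        have h2 := continuous_cis
        simp only [ev]
        fun_prop⟩
      map_add' := fun p q => by
        ext φ; simp [ev, add_mul]; ring
      map_smul' := fun r p => by
        ext φ
        simp only [ev, Submodule.coe_smul, ContinuousMap.coe_mk, RingHom.id_apply,
          ContinuousMap.coe_smul, Pi.smul_apply, smul_eq_mul]
        rw [← Complex.coe_smul, smul_eq_C_mul, eval_mul, eval_C, mul_assoc, Complex.re_ofReal_mul]
        ring }
  have hΦ : Function.Injective Φ := by
    rw [← LinearMap.ker_eq_bot, LinearMap.ker_eq_bot']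
    intro p hp
    obtain ⟨f, hf⟩ := p.2
    ext1
    -- Any 2n + 1 points of (0, π) would do: the weight is positive there, so f itself vanishes.
    refine hf.eq_zero_of_zeros ((Finset.range (2 * n + 1)).image fun k : ℕ => (1 : ℝ) / (k + 1)) ?_
      ?_ ?_
    · rw [Finset.card_image_of_injective]
      · simp
      · intro i j hij
        simpa using hij
    · simp only [Finset.mem_image, forall_exists_index, and_imp, forall_apply_eq_imp_iff₂]
      intro i _ j _
      have h1 : ∀ k : ℕ, 0 < (1 : ℝ) / (k + 1) ∧ (1 : ℝ) / (k + 1) ≤ 1 := fun k =>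
        ⟨by positivity, by rw [div_le_one (by positivity)]; linarith [k.cast_nonneg (α := ℝ)]⟩
      have := Real.pi_gt_three
      rw [abs_lt]
      constructor <;> linarith [(h1 i).1, (h1 i).2, (h1 j).1, (h1 j).2]
    · simp only [Finset.mem_image, forall_exists_index, and_imp, forall_apply_eq_imp_iff₂]
      intro k _
      have hk : 0 < (1 : ℝ) / (k + 1) ∧ (1 : ℝ) / (k + 1) ≤ 1 :=
        ⟨by positivity, by rw [div_le_one (by positivity)]; linarith [k.cast_nonneg (α := ℝ)]⟩
      have hpi := Real.pi_gt_three
      have h2 : (1 : ℝ) / (k + 1) ∈ K := ⟨by linarith, by linarith⟩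
      have h3 := congrArg (fun F : C(K, ℝ) => F ⟨_, h2⟩) hp
      simp only [Φ, LinearMap.coe_mk, AddHom.coe_mk, ContinuousMap.coe_mk, ContinuousMap.zero_apply]
        at h3
      rw [hev f p hf] at h3
      refine (mul_eq_zero.1 h3).resolve_left (jacobiWeight_pos ?_).ne'
      exact (Real.sin_pos_of_pos_of_lt_pi hk.1 (by linarith)).ne'
  let _ : NormedAddCommGroup (trigSubspace (2 * n)) := NormedAddCommGroup.induced _ _ Φ hΦ
  let _ : NormedSpace ℝ (trigSubspace (2 * n)) := NormedSpace.induced ℝ _ _ Φ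
  have := finiteDimensional_trigSubspace (2 * n)
  have hproper : ProperSpace (trigSubspace (2 * n)) := FiniteDimensional.proper_real _
  let ℓ : trigSubspace (2 * n) →ₗ[ℝ] ℂ :=
    { toFun := fun p => (p : ℂ[X]).coeff (2 * n)
      map_add' := fun p q => by simp
      map_smul' := fun r p => by simp }
  have hℓ : Continuous ℓ := ℓ.continuous_of_finiteDimensional
  have hcl : IsClosed (ℓ ⁻¹' Λ) := hΛ.preimage hℓ
  have hne : (ℓ ⁻¹' Λ).Nonempty := ⟨⟨p₀, f₀, hf₀⟩, hp₀⟩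
  obtain ⟨p, hp, hmin⟩ := hcl.exists_infDist_eq_dist hne 0
  have hmin' : ∀ q ∈ ℓ ⁻¹' Λ, ‖p‖ ≤ ‖q‖ := by
    intro q hq
    have := Metric.infDist_le_dist_of_mem (x := 0) hq
    rw [hmin] at this
    simpa using this
  obtain ⟨f, hf⟩ := p.2
  have hnorm : ∀ (g : ℝ → ℝ) (q : trigSubspace (2 * n)), TrigRep (2 * n) g q → ∀ M' : ℝ, 0 ≤ M' →
      (‖q‖ ≤ M' ↔ ∀ φ, |jacobiWeight a b φ * g φ| ≤ M') := by
    intro g q hg M' hM'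
    have e : ‖q‖ = ‖Φ q‖ := rfl
    rw [e, ContinuousMap.norm_le _ hM']
    have h1 : ∀ x : K, Φ q x = jacobiWeight a b x * g x := by
      intro x
      simp only [Φ, LinearMap.coe_mk, AddHom.coe_mk, ContinuousMap.coe_mk]
      rw [hev g q hg]
    constructor
    · intro h
      apply forall_of_periodic
      · intro φ
        rw [jacobiWeight_periodic φ, hg.periodic φ]
      · intro φ hφ
        have := h ⟨φ, hφ⟩
        rwa [h1] at this
    · intro h x
      rw [h1]; exact h x
  refine ⟨f, p, ‖p‖, hf, hp, ?_, (hnorm f p hf _ (norm_nonneg _)).1 le_rfl, ?_⟩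
  · rw [norm_pos_iff]
    rintro rfl
    exact h0 (by simpa [ℓ] using hp)
  · intro g q M' hg hq hM'
    have hM0 : 0 ≤ M' := (abs_nonneg _).trans (hM' 0)
    exact (hmin' ⟨q, g, hg⟩ hq).trans ((hnorm g ⟨q, g, hg⟩ hg M' hM0).2 hM')

/-! ### First-order variations and critical points. -/

namespace IsExtremal

variable {a b : ℝ} {n : ℕ} {Λ : Set ℂ} {f : ℝ → ℝ} {p : ℂ[X]} {M : ℝ}

theorem sin_ne_zero (ha : 0 < a) (hb : 0 < b) (h : IsExtremal a b n Λ f p M) {φ : ℝ}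
    (hφ : |jacobiWeight a b φ * f φ| = M) : Real.sin φ ≠ 0 := by
  intro h0
  rw [jacobiWeight_eq_zero ha hb h0] at hφ
  simp at hφ
  exact h.pos.ne hφ

/-- If the sup norm can be made strictly smaller than `M` on a period, then `M` is not minimal. -/
theorem not_forall_lt (ha : 0 < a) (hb : 0 < b) (h : IsExtremal a b n Λ f p M) {g : ℝ → ℝ}
    {q : ℂ[X]} (hg : TrigRep (2 * n) g q) (hq : q.coeff (2 * n) ∈ Λ) :
    ¬ ∀ φ ∈ Set.Icc (-Real.pi) Real.pi, |jacobiWeight a b φ * g φ| < M := by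
  intro hlt
  have hc : Continuous fun φ => |jacobiWeight a b φ * g φ| :=
    ((continuous_jacobiWeight ha hb).mul hg.continuous).abs
  have hpi := Real.pi_pos
  obtain ⟨x, hx, hmax⟩ := (isCompact_Icc (a := -Real.pi) (b := Real.pi)).exists_isMaxOn
    ⟨0, by constructor <;> linarith⟩ hc.continuousOn
  have := h.le g q _ hg hq (forall_of_periodic
    (P := fun φ => |jacobiWeight a b φ * g φ| ≤ |jacobiWeight a b x * g x|)
    (fun φ => by rw [jacobiWeight_periodic φ, hg.periodic φ]) fun φ hφ => hmax hφ)
  linarith [hlt x hx]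

/-- Kolmogorov's criterion: no admissible direction decreases the modulus at all extremal points. -/
theorem exists_nonneg (ha : 0 < a) (hb : 0 < b) (h : IsExtremal a b n Λ f p M) {g : ℝ → ℝ}
    {q : ℂ[X]} (hg : TrigRep (2 * n) g q) {ε₀ : ℝ} (hε₀ : 0 < ε₀)
    (hΛ : ∀ ε : ℝ, 0 < ε → ε < ε₀ → (p + C (ε : ℂ) * q).coeff (2 * n) ∈ Λ) :
    ∃ φ ∈ Set.Icc (-Real.pi) Real.pi, |jacobiWeight a b φ * f φ| = M ∧ 0 ≤ g φ * f φ := by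
  -- If g f < 0 at every extremal point, then |w(f + εg)| < M near each point of the period for
  -- small ε > 0. Compactness makes ε uniform.
  by_contra! hcon
  have hw := continuous_jacobiWeight ha hb
  have hfc := h.rep.continuous
  have hgc := hg.continuous
  have key : ∀ φ ∈ Set.Icc (-Real.pi) Real.pi, ∀ᶠ z : ℝ × ℝ in nhds (0, φ),
      0 < z.1 → |jacobiWeight a b z.2 * (f z.2 + z.1 * g z.2)| < M := by
    intro φ hφ
    rcases (h.bound φ).lt_or_eq with hlt | heq
    · have hc : Continuous fun z : ℝ × ℝ => |jacobiWeight a b z.2 * (f z.2 + z.1 * g z.2)| := by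
        fun_prop
      have := hc.tendsto (0, φ)
      simp only [zero_mul, add_zero] at this
      exact (this.eventually (gt_mem_nhds hlt)).mono fun z hz _ => hz
    · have hneg := hcon φ hφ heq
      have hc1 : Continuous fun z : ℝ × ℝ => 2 * (g z.2 * f z.2) + z.1 * g z.2 ^ 2 := by fun_prop
      have h1 : ∀ᶠ z : ℝ × ℝ in nhds (0, φ), 2 * (g z.2 * f z.2) + z.1 * g z.2 ^ 2 < 0 := by
        refine (hc1.tendsto (0, φ)).eventually (gt_mem_nhds ?_)
        simp only [zero_mul, add_zero]; linarith
      have hc2 : Continuous fun z : ℝ × ℝ => jacobiWeight a b z.2 := by fun_prop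
      have h2 : ∀ᶠ z : ℝ × ℝ in nhds (0, φ), 0 < jacobiWeight a b z.2 :=
        (hc2.tendsto (0, φ)).eventually (lt_mem_nhds (jacobiWeight_pos (h.sin_ne_zero ha hb heq)))
      filter_upwards [h1, h2] with z hz1 hz2 hz
      refine lt_of_lt_of_le ?_ (h.bound z.2)
      apply sq_lt_sq.1
      have : (jacobiWeight a b z.2 * f z.2) ^ 2 - (jacobiWeight a b z.2 * (f z.2 + z.1 * g z.2)) ^ 2
          = -(jacobiWeight a b z.2 ^ 2 * z.1 * (2 * (g z.2 * f z.2) + z.1 * g z.2 ^ 2)) := by ring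
      have h3 : 0 < jacobiWeight a b z.2 ^ 2 * z.1 := by positivity
      nlinarith
  have hev := (isCompact_Icc (a := -Real.pi) (b := Real.pi)).eventually_forall_of_forall_eventually
    (P := fun ε φ => 0 < ε → |jacobiWeight a b φ * (f φ + ε * g φ)| < M) key
  obtain ⟨δ, hδ, hball⟩ := Metric.eventually_nhds_iff.1 hev
  obtain ⟨ε, hε0, hε⟩ := exists_between (lt_min hδ hε₀)
  have hεδ : dist ε 0 < δ := by
    rw [Real.dist_eq, sub_zero, abs_of_pos hε0]; exact hε.trans_le (min_le_left _ _)
  refine h.not_forall_lt ha hb (h.rep.add (hg.smul ε)) (hΛ ε hε0 (hε.trans_le (min_le_right _ _))) ?_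
  intro φ hφ
  exact hball hεδ φ hφ hε0

end IsExtremal

/-- The trigonometric polynomial whose zeros are the critical points of `jacobiWeight * f`. -/
theorem TrigRep.critical {n : ℕ} {f f' : ℝ → ℝ} {p p' : ℂ[X]} (hf : TrigRep (2 * n) f p)
    (hf' : TrigRep (2 * n) f' p') (hp' : p'.coeff (2 * n) = Complex.I * n * p.coeff (2 * n))
    (a b : ℝ) :
    ∃ P, TrigRep (2 * n + 2)
      (fun φ => Real.sin φ * f' φ + ((a + b) * Real.cos φ + (a - b)) * f φ) P ∧
      P.coeff (2 * n + 2) = (n + a + b : ℝ) / 2 * p.coeff (2 * n) := by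
  have h1 := TrigRep.sin.mul hf'
  have h2 := (TrigRep.cos.smul (a + b)).mul hf
  have h3 := (hf.smul (a - b)).raise
  rw [add_comm 2 (2 * n)] at h1 h2
  have h4 := (h1.add h2).add h3
  have e : (fun φ => Real.sin φ * f' φ + ((a + b) * Real.cos φ + (a - b)) * f φ) = fun φ =>
      Real.sin φ * f' φ + (a + b) * Real.cos φ * f φ + (a - b) * f φ := by
    funext φ; ring
  rw [← e] at h4
  refine ⟨_, h4, ?_⟩
  -- The sine term contributes n/2 and the cosine term (a + b)/2; the term (a - b)f has lower level.
  · rw [coeff_add, coeff_add, add_comm (2 * n) 2,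
      coeff_mul_add_eq_of_natDegree_le TrigRep.sin.1 hf'.1,
      coeff_mul_add_eq_of_natDegree_le (TrigRep.cos.smul (a + b)).1 hf.1, hp']
    have h5 : (C ((a - b : ℝ) : ℂ) * p * X).coeff (2 + 2 * n) = 0 := by
      rw [show 2 + 2 * n = (2 * n + 1) + 1 by ring, coeff_mul_X, coeff_C_mul,
        coeff_eq_zero_of_natDegree_lt (Nat.lt_succ_of_le hf.1), mul_zero]
    rw [h5]
    simp only [coeff_C_mul, coeff_sub, coeff_add, coeff_X_pow, coeff_one]
    push_cast
    norm_num
    linear_combination (-(n : ℂ) / 2 * p.coeff (2 * n)) * Complex.I_sq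

theorem TrigRep.hasDerivAt_lead {n : ℕ} {f : ℝ → ℝ} {p : ℂ[X]} (hf : TrigRep (2 * n) f p) :
    ∃ f' p', TrigRep (2 * n) f' p' ∧ p'.coeff (2 * n) = Complex.I * n * p.coeff (2 * n) ∧
      ∀ φ, HasDerivAt f (f' φ) φ := by
  obtain ⟨f', hf', hd⟩ := hf.hasDerivAt
  refine ⟨f', _, hf', ?_, hd⟩
  rw [coeff_C_mul, coeff_sub, coeff_C_mul]
  rcases Nat.eq_zero_or_pos n with rfl | hn
  · simp
  · obtain ⟨m, hm⟩ : ∃ m, 2 * n = m + 1 := ⟨2 * n - 1, by omega⟩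
    rw [hm, mul_comm X, coeff_mul_X, coeff_derivative]
    have : ((m + 1 : ℕ) : ℂ) = 2 * n := by rw [← hm]; push_cast; ring
    push_cast at this ⊢
    linear_combination (Complex.I * p.coeff (m + 1) / 2) * this

theorem hasDerivAt_weight_mul {a b φ f' : ℝ} {f : ℝ → ℝ} (h : Real.sin φ ≠ 0)
    (hf : HasDerivAt f f' φ) :
    HasDerivAt (fun x => jacobiWeight a b x * f x)
      (jacobiWeight a b φ * (Real.sin φ * f' + ((a + b) * Real.cos φ + (a - b)) * f φ) /
        Real.sin φ) φ := by
  refine ((hasDerivAt_jacobiWeight h).mul hf).congr_deriv ?_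
  field_simp
  ring

theorem IsExtremal.critical_eq_zero {a b : ℝ} (ha : 0 < a) (hb : 0 < b) {n : ℕ} {Λ : Set ℂ}
    {f f' : ℝ → ℝ} {p : ℂ[X]} {M : ℝ} (h : IsExtremal a b n Λ f p M)
    (hf' : ∀ φ, HasDerivAt f (f' φ) φ) {φ : ℝ} (hφ : |jacobiWeight a b φ * f φ| = M) :
    Real.sin φ * f' φ + ((a + b) * Real.cos φ + (a - b)) * f φ = 0 := by
  have hs := h.sin_ne_zero ha hb hφ
  have hd := hasDerivAt_weight_mul (a := a) (b := b) hs (hf' φ)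
  have hz : jacobiWeight a b φ * (Real.sin φ * f' φ + ((a + b) * Real.cos φ + (a - b)) * f φ) /
        Real.sin φ = 0 := by
    rcases le_total 0 (jacobiWeight a b φ * f φ) with h0 | h0
    · rw [abs_of_nonneg h0] at hφ
      refine IsLocalMax.hasDerivAt_eq_zero (Filter.Eventually.of_forall fun x => ?_) hd
      rw [hφ]; exact (le_abs_self _).trans (h.bound x)
    · rw [abs_of_nonpos h0] at hφ
      refine IsLocalMin.hasDerivAt_eq_zero (Filter.Eventually.of_forall fun x => ?_) hd
      have := (neg_le_abs _).trans (h.bound x)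
      linarith
  have hw := (jacobiWeight_pos (a := a) (b := b) hs).ne'
  simpa [hs, hw] using hz

/-- Extremal points are zeros of the critical polynomial, which is nonzero because its top
coefficient is (n + a + b)/2 times that of p. Finiteness makes the convex hull in
`IsExtremal.exists_isAlternating` closed. -/
theorem IsExtremal.finite_extremal {a b : ℝ} (ha : 0 < a) (hb : 0 < b) {n : ℕ} {Λ : Set ℂ}
    {f : ℝ → ℝ} {p : ℂ[X]} {M : ℝ} (h : IsExtremal a b n Λ f p M) (h0 : p.coeff (2 * n) ≠ 0) :
    {φ ∈ Set.Icc (-Real.pi) Real.pi | |jacobiWeight a b φ * f φ| = M}.Finite := by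
  obtain ⟨f', p', hf', hl, hd⟩ := h.rep.hasDerivAt_lead
  obtain ⟨P, hP, hPl⟩ := h.rep.critical hf' hl a b
  have hP0 : P ≠ 0 := by
    rintro rfl
    rw [coeff_zero] at hPl
    have : ((n + a + b : ℝ) : ℂ) ≠ 0 := by
      have : (0 : ℝ) < n + a + b := by positivity
      exact_mod_cast this.ne'
    exact mul_ne_zero (div_ne_zero this two_ne_zero) h0 hPl.symm
  have hfin : {z | P.IsRoot z}.Finite := P.finite_setOfPred_isRoot hP0
  refine Set.Finite.of_finite_image (f := cis) (hfin.subset ?_) ?_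
  · rintro _ ⟨φ, ⟨_, hφ⟩, rfl⟩
    exact (hP.zero_iff φ).1 (h.critical_eq_zero ha hb hd hφ)
  · have hne : ∀ x ∈ {φ ∈ Set.Icc (-Real.pi) Real.pi | |jacobiWeight a b φ * f φ| = M},
        -Real.pi < x := by
      rintro x ⟨hx, hxM⟩
      refine lt_of_le_of_ne hx.1 ?_
      rintro rfl
      exact h.sin_ne_zero ha hb hxM (by simp)
    intro x hx y hy hxy
    refine cis_injective_of_abs_lt ?_ hxy
    have h1 := hne x hx
    have h2 := hne y hy
    have h3 := hx.1.2
    have h4 := hy.1.2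
    rw [abs_lt]; constructor <;> linarith

/-! ### The moment curve and quadrature relations. -/

theorem TrigRep.cos_add_sin {k j : ℕ} (hj : j ≤ k) (α β : ℝ) :
    ∃ q, TrigRep (2 * k) (fun φ => α * Real.cos (j * φ) + β * Real.sin (j * φ)) q := by
  refine ⟨C ((α - β * Complex.I) / 2) * X ^ (k + j) + C ((α + β * Complex.I) / 2) * X ^ (k - j),
    ?_, fun φ => ?_⟩
  · refine (natDegree_add_le _ _).trans (max_le ?_ ?_) <;>
    refine (natDegree_C_mul_X_pow_le _ _).trans (by omega)
  · have h1 : ((2 * k : ℕ) : ℝ) * φ / 2 = k * φ := by push_cast; ring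
    have e1 : cis φ ^ (k + j) = cis (k * φ) * cis (j * φ) := by
      rw [cis_pow, ← cis_add]; congr 1; push_cast; ring
    have e2 : cis φ ^ (k - j) = cis (k * φ) * cis (-(j * φ)) := by
      rw [cis_pow, ← cis_add]; congr 1; push_cast [Nat.cast_sub hj]; ring
    rw [h1]
    simp only [eval_add, eval_mul, eval_C, eval_pow, eval_X]
    rw [e1, e2, cis_eq (j * φ), cis_eq (-(j * φ)), Real.cos_neg, Real.sin_neg]
    push_cast
    linear_combination (cis (k * φ) * β * Complex.sin (j * φ)) * Complex.I_sq

theorem TrigRep.exists_sum {ι : Type*} {m : ℕ} (s : Finset ι) (g : ι → ℝ → ℝ)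
    (h : ∀ i ∈ s, ∃ q, TrigRep m (g i) q) : ∃ q, TrigRep m (fun φ => ∑ i ∈ s, g i φ) q := by
  classical
  induction s using Finset.induction_on with
  | empty => exact ⟨0, by simp, by simp⟩
  | insert a s ha ih =>
    obtain ⟨q, hq⟩ := ih fun i hi => h i (Finset.mem_insert_of_mem hi)
    obtain ⟨r, hr⟩ := h a (Finset.mem_insert_self a s)
    refine ⟨r + q, ?_⟩
    simp_rw [Finset.sum_insert ha]
    exact hr.add hq

/-- The moment curve `φ ↦ (1, e^{iφ}, …, e^{ikφ})`. -/
noncomputable def trigMoment (k : ℕ) (φ : ℝ) : ℝ × (Fin k → ℂ) :=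
  (1, fun j => cis ((j + 1 : ℕ) * φ))

/-- A separating hyperplane in moment space thereby becomes a direction of variation of degree at
most k. -/
theorem TrigRep.of_dual (k : ℕ) (ℓ : ℝ × (Fin k → ℂ) →ₗ[ℝ] ℝ) :
    ∃ q, TrigRep (2 * k) (fun φ => ℓ (trigMoment k φ)) q := by
  classical
  have e : (fun φ => ℓ (trigMoment k φ)) = fun φ => (ℓ (1, 0) * Real.cos ((0 : ℕ) * φ) +
      0 * Real.sin ((0 : ℕ) * φ)) + ∑ j : Fin k, (ℓ (0, Pi.single j 1) *
      Real.cos ((j + 1 : ℕ) * φ) + ℓ (0, Pi.single j Complex.I) * Real.sin ((j + 1 : ℕ) * φ)) := by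
    funext φ
    have h1 : trigMoment k φ = (1, 0) + ∑ j : Fin k,
        (Real.cos ((j + 1 : ℕ) * φ) • ((0 : ℝ), (Pi.single j 1 : Fin k → ℂ)) +
          Real.sin ((j + 1 : ℕ) * φ) • ((0 : ℝ), (Pi.single j Complex.I : Fin k → ℂ))) := by
      refine Prod.ext ?_ ?_
      · simp [trigMoment, Prod.fst_sum]
      · simp only [trigMoment, Prod.snd_add, Prod.snd_sum, Prod.smul_snd, zero_add]
        funext i
        simp only [Finset.sum_apply, Pi.add_apply, Pi.smul_apply, Pi.single_apply, cis_eq]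
        rw [Finset.sum_eq_single i]
        · simp
        · intro j _ hj
          simp [hj.symm]
        · simp
    rw [h1, map_add, map_sum]
    simp only [map_add, map_smul, smul_eq_mul]
    simp [mul_comm]
  rw [e]
  obtain ⟨q, hq⟩ := TrigRep.cos_add_sin (Nat.zero_le k) (ℓ (1, 0)) 0
  obtain ⟨r, hr⟩ := TrigRep.exists_sum (Finset.univ : Finset (Fin k)) _
    fun j _ => TrigRep.cos_add_sin (k := k) (j := j + 1) (by omega) (ℓ (0, Pi.single j 1))
      (ℓ (0, Pi.single j Complex.I))
  exact ⟨_, hq.add hr⟩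

/-- A linear relation among points of the moment curve is a quadrature relation. -/
theorem TrigRep.sum_eq_zero_of_moment {ι : Type*} [Fintype ι] {k : ℕ} {c y : ι → ℝ}
    (h : ∑ i, c i • trigMoment k (y i) = 0) {g : ℝ → ℝ} {q : ℂ[X]} (hg : TrigRep (2 * k) g q) :
    ∑ i, c i * g (y i) = 0 := by
  have h0 : ∑ i, c i = 0 := by
    simpa [trigMoment, Prod.fst_sum] using congrArg Prod.fst h
  have hpos : ∀ j : ℕ, j < k → ∑ i, (c i : ℂ) * cis ((j + 1 : ℕ) * y i) = 0 := by
    intro j hj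
    have := congrFun (congrArg Prod.snd h) ⟨j, hj⟩
    simpa [trigMoment, Prod.snd_sum, Finset.sum_apply] using this
  have hpos' : ∀ j : ℕ, j ≤ k → ∑ i, (c i : ℂ) * cis (j * y i) = 0 := by
    intro j hj
    rcases j with _ | j
    · simp [cis_zero]; exact_mod_cast h0
    · exact hpos j hj
  -- The coefficients are real, so conjugation supplies the negative frequencies.
  have hneg : ∀ j : ℕ, j ≤ k → ∑ i, (c i : ℂ) * cis (-(j * y i)) = 0 := by
    intro j hj
    have := congrArg (starRingEnd ℂ) (hpos' j hj)
    simpa [map_sum, conj_cis] using this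
  have hall : ∀ l ∈ Finset.range (2 * k + 1), ∑ i, (c i : ℂ) * (q.coeff l * cis (y i) ^ l *
      cis (-(k * y i))) = 0 := by
    intro l hl
    have : ∀ i, (c i : ℂ) * (q.coeff l * cis (y i) ^ l * cis (-(k * y i))) =
        q.coeff l * ((c i : ℂ) * cis (((l : ℝ) - k) * y i)) := by
      intro i
      have e : cis (((l : ℝ) - k) * y i) = cis (y i) ^ l * cis (-(k * y i)) := by
        rw [cis_pow, ← cis_add]; congr 1; ring
      rw [e]; ring
    simp_rw [this]
    rw [← Finset.mul_sum]
    rcases le_total k l with h1 | h1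
    · have := hpos' (l - k) (by have := Finset.mem_range.1 hl; omega)
      rw [Nat.cast_sub h1] at this
      rw [this, mul_zero]
    · have := hneg (k - l) (by omega)
      simp_rw [Nat.cast_sub h1, ← neg_mul, neg_sub] at this
      rw [this, mul_zero]
  have hsum : ((∑ i, c i * g (y i) : ℝ) : ℂ) = 0 := by
    push_cast
    have : ∀ i, (g (y i) : ℂ) = ∑ l ∈ Finset.range (2 * k + 1), q.coeff l * cis (y i) ^ l *
        cis (-(k * y i)) := by
      intro i
      rw [hg.eq_mul_cis, eval_eq_sum_range' (Nat.lt_succ_of_le hg.1), Finset.sum_mul]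
      refine Finset.sum_congr rfl fun l _ => ?_
      congr 2; push_cast; ring
    simp_rw [this, Finset.mul_sum]
    rw [Finset.sum_comm]
    exact Finset.sum_eq_zero hall
  exact_mod_cast hsum

/-- The supports of quadrature relations of minimal size carry alternating coefficients. -/
theorem quadrature_alternating {k N : ℕ} (hN : N ≤ 2 * k + 2) (hN0 : 0 < N) {x c : Fin N → ℝ}
    (hx : StrictMono x) (hper : ∀ i j, x j - x i < 2 * Real.pi) (hc : ∀ i, c i ≠ 0)
    (h : ∀ g q, TrigRep (2 * k) g q → ∑ i, c i * g (x i) = 0) :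
    N = 2 * k + 2 ∧ ∀ i j : Fin N, (j : ℕ) = i + 1 → c i * c j < 0 := by
  classical
  have hNeq : N = 2 * k + 2 := by
    -- With fewer nodes some test function vanishes at every node except x i₀. The spare factors,
    -- with zero at x i₀ - π, fill up the level and equal 1 at x i₀.
    by_contra hne
    let i₀ : Fin N := ⟨0, hN0⟩
    have hcard : (Finset.univ.erase i₀).card + (Finset.range (2 * k - (N - 1))).card = 2 * k := by
      rw [Finset.card_erase_of_mem (Finset.mem_univ _), Finset.card_univ, Fintype.card_fin,
        Finset.card_range]
      omega
    have h1 := (TrigRep.prod_sin_half (Finset.univ.erase i₀) x).mul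
      (TrigRep.prod_sin_half (Finset.range (2 * k - (N - 1))) fun _ => x i₀ - Real.pi)
    rw [hcard] at h1
    have h2 := h _ _ h1
    rw [Finset.sum_eq_single i₀] at h2
    · have h3 := (sign_prod_sin_half hx hper i₀).ne'
      have h4 : ∏ i ∈ Finset.univ.erase i₀, Real.sin ((x i₀ - x i) / 2) ≠ 0 :=
        right_ne_zero_of_mul h3
      have h5 : Real.sin ((x i₀ - (x i₀ - Real.pi)) / 2) = 1 := by
        rw [sub_sub_cancel, Real.sin_pi_div_two]
      simp only [h5, Finset.prod_const_one, mul_one] at h2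
      exact mul_ne_zero (hc i₀) h4 h2
    · intro i _ hi
      have : ∏ j ∈ Finset.univ.erase i₀, Real.sin ((x i - x j) / 2) = 0 :=
        Finset.prod_eq_zero (Finset.mem_erase.2 ⟨hi, Finset.mem_univ i⟩) (by simp)
      rw [this]; ring
    · simp
  refine ⟨hNeq, fun i j hij => ?_⟩
  have hne : i ≠ j := by rintro rfl; omega
  -- A test function vanishing at all nodes but two neighbours takes values of the same sign there,
  -- so the two coefficients must have opposite signs.
  set s := (Finset.univ.erase i).erase j with hs
  have hcard : s.card = 2 * k := by
    rw [hs, Finset.card_erase_of_mem (Finset.mem_erase.2 ⟨hne.symm, Finset.mem_univ j⟩),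
      Finset.card_erase_of_mem (Finset.mem_univ _), Finset.card_univ, Fintype.card_fin]
    omega
  have h1 := TrigRep.prod_sin_half s x
  rw [hcard] at h1
  have h2 := h _ _ h1
  have hzero : ∀ l, l ≠ i → l ≠ j → c l * ∏ r ∈ s, Real.sin ((x l - x r) / 2) = 0 := by
    intro l hli hlj
    have : ∏ r ∈ s, Real.sin ((x l - x r) / 2) = 0 :=
      Finset.prod_eq_zero (i := l) (by simp [hs, hli, hlj]) (by simp)
    rw [this, mul_zero]
  rw [← Finset.add_sum_erase _ _ (Finset.mem_univ i), Finset.sum_eq_single j] at h2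
  · have hpos : 0 < (∏ r ∈ s, Real.sin ((x i - x r) / 2)) * ∏ r ∈ s, Real.sin ((x j - x r) / 2) := by
      rw [← Finset.prod_mul_distrib]
      refine Finset.prod_pos fun r hr => ?_
      simp only [hs, Finset.mem_erase, Finset.mem_univ, and_true] at hr
      have p1 := hper r i
      have p2 := hper r j
      have p3 := hper i r
      have p4 := hper j r
      rcases lt_or_ge r i with hri | hri
      · have q1 := hx hri
        have q2 := hx (hri.trans (show i < j by rw [Fin.lt_def]; omega))
        exact mul_pos (Real.sin_pos_of_pos_of_lt_pi (by linarith) (by linarith))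
          (Real.sin_pos_of_pos_of_lt_pi (by linarith) (by linarith))
      · have hjr : j < r := by
          have h5 : (r : ℕ) ≠ i := fun h6 => hr.2 (Fin.ext h6)
          have h7 : (r : ℕ) ≠ j := fun h6 => hr.1 (Fin.ext h6)
          have h8 : (i : ℕ) ≤ r := hri
          rw [Fin.lt_def]; omega
        have q1 := hx hjr
        have q2 := hx (show i < r from lt_trans (by rw [Fin.lt_def]; omega) hjr)
        exact mul_pos_of_neg_of_neg (Real.sin_neg_of_neg_of_neg_pi_lt (by linarith) (by linarith))
          (Real.sin_neg_of_neg_of_neg_pi_lt (by linarith) (by linarith))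
    have hci := hc i
    set u := ∏ r ∈ s, Real.sin ((x i - x r) / 2)
    set v := ∏ r ∈ s, Real.sin ((x j - x r) / 2)
    have h3 : c i * c j * (u * v) = -(c i * u) ^ 2 := by linear_combination (c i * u) * h2
    have hu : u ≠ 0 := left_ne_zero_of_mul hpos.ne'
    have h4 : 0 < (c i * u) ^ 2 := by positivity
    by_contra hcon
    have := mul_nonneg (not_lt.1 hcon) hpos.le
    linarith
  · intro l hl hlj
    exact hzero l (Finset.ne_of_mem_erase hl) hlj
  · intro hj
    exact absurd (Finset.mem_erase.2 ⟨hne.symm, Finset.mem_univ j⟩) hj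

/-! ### Alternation of extremal polynomials. -/

/-- Points of a period at which `jacobiWeight * f` takes the values `±M` alternately. -/
structure IsAlternating (a b : ℝ) (f : ℝ → ℝ) (M ε : ℝ) {N : ℕ} (x : Fin N → ℝ) : Prop where
  strictMono : StrictMono x
  sq_eq : ε ^ 2 = 1
  eq : ∀ i : Fin N, jacobiWeight a b (x i) * f (x i) = ε * (-1) ^ (i : ℕ) * M

theorem isAlternating_of_mul_neg {a b : ℝ} {f : ℝ → ℝ} {M : ℝ} {N : ℕ} {x : Fin N → ℝ}
    (hx : StrictMono x) (habs : ∀ i, |jacobiWeight a b (x i) * f (x i)| = M)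
    (hneg : ∀ i j : Fin N, (j : ℕ) = i + 1 → f (x i) * f (x j) < 0) :
    ∃ ε, IsAlternating a b f M ε x := by
  rcases Nat.eq_zero_or_pos N with rfl | hN
  · exact ⟨1, hx, by norm_num, fun i => i.elim0⟩
  have hval : ∀ i, jacobiWeight a b (x i) * f (x i) = M ∨ jacobiWeight a b (x i) * f (x i) = -M :=
    fun i => eq_or_eq_neg_of_abs_eq (habs i)
  obtain ⟨ε, hε, h0⟩ : ∃ ε : ℝ, ε ^ 2 = 1 ∧
      jacobiWeight a b (x ⟨0, hN⟩) * f (x ⟨0, hN⟩) = ε * M := by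
    rcases hval ⟨0, hN⟩ with h | h
    · exact ⟨1, by norm_num, by rw [h, one_mul]⟩
    · exact ⟨-1, by norm_num, by rw [h]; ring⟩
  refine ⟨ε, hx, hε, ?_⟩
  rintro ⟨i, hi⟩
  induction i with
  | zero => simpa using h0
  | succ i ih =>
    have h1 := ih (by omega)
    have h2 := hneg ⟨i, by omega⟩ ⟨i + 1, hi⟩ rfl
    have h3 : jacobiWeight a b (x ⟨i, by omega⟩) * f (x ⟨i, by omega⟩) *
        (jacobiWeight a b (x ⟨i + 1, hi⟩) * f (x ⟨i + 1, hi⟩)) ≤ 0 := by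
      have w1 := jacobiWeight_nonneg (a := a) (b := b) (x ⟨i, by omega⟩)
      have w2 := jacobiWeight_nonneg (a := a) (b := b) (x ⟨i + 1, hi⟩)
      have := mul_nonneg w1 w2
      nlinarith
    rw [h1] at h3
    have hsq : (ε * (-1) ^ i) ^ 2 = 1 := by rw [mul_pow, hε, ← pow_mul, mul_comm i, pow_mul]; simp
    have hM : 0 ≤ M := by rw [← habs ⟨0, hN⟩]; exact abs_nonneg _
    rw [pow_succ]
    have hs : ε * (-1) ^ i = 1 ∨ ε * (-1) ^ i = -1 := sq_eq_one_iff.1 hsq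
    simp only at h3 ⊢
    rw [show ε * ((-1) ^ i * -1) * M = -(ε * (-1) ^ i) * M by ring]
    have hMM : M * M ≤ 0 → M = 0 := fun h4 => mul_self_eq_zero.1 (le_antisymm h4 (mul_self_nonneg M))
    rcases hs with hs | hs <;> rcases hval ⟨i + 1, hi⟩ with h4 | h4 <;> rw [h4, hs] at h3 <;>
      rw [h4, hs]
    · rw [hMM (by linarith)]; ring
    · ring
    · ring
    · rw [hMM (by linarith)]; ring

/-- Directions of degree k leave the top coefficient unchanged. By Kolmogorov's criterion for them,
0 lies in the convex hull of the vectors f(φ)·`trigMoment k φ` over the extremal points.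
Carathéodory in real dimension 2k + 1 keeps at most 2k + 2 of these, and `quadrature_alternating`
shows that there are exactly that many and that f alternates on them. -/
theorem IsExtremal.exists_isAlternating {a b : ℝ} (ha : 0 < a) (hb : 0 < b) {k : ℕ} {Λ : Set ℂ}
    {f : ℝ → ℝ} {p : ℂ[X]} {M : ℝ} (h : IsExtremal a b (k + 1) Λ f p M)
    (h0 : p.coeff (2 * (k + 1)) ≠ 0) :
    ∃ ε, ∃ x : Fin (2 * (k + 1)) → ℝ, IsAlternating a b f M ε x ∧
      ∀ i, x i ∈ Set.Ioo (-Real.pi) Real.pi := by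
  classical
  set A := {φ ∈ Set.Icc (-Real.pi) Real.pi | |jacobiWeight a b φ * f φ| = M} with hA
  have hAfin : A.Finite := h.finite_extremal ha hb h0
  have hAIoo : ∀ φ ∈ A, φ ∈ Set.Ioo (-Real.pi) Real.pi := by
    rintro φ ⟨⟨h1, h2⟩, h3⟩
    have hs := h.sin_ne_zero ha hb h3
    refine ⟨lt_of_le_of_ne h1 ?_, lt_of_le_of_ne h2 ?_⟩ <;> rintro rfl <;> simp at hs
  have hfA : ∀ φ ∈ A, f φ ≠ 0 := by
    rintro φ ⟨_, h3⟩ h4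
    rw [h4, mul_zero, abs_zero] at h3
    exact h.pos.ne h3
  set K := (fun φ => f φ • trigMoment k φ) '' A with hK
  have hmem : (0 : ℝ × (Fin k → ℂ)) ∈ convexHull ℝ K := by
    by_contra hnot
    have hcl : IsClosed (convexHull ℝ K) := ((hAfin.image _).isCompact_convexHull ℝ).isClosed
    obtain ⟨ℓ, u, hu0, hu⟩ := geometric_hahn_banach_point_closed (convex_convexHull ℝ K) hcl hnot
    rw [map_zero] at hu0
    obtain ⟨q, hq⟩ := TrigRep.of_dual k ℓ.toLinearMap
    have hq' := hq.neg.raise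
    obtain ⟨φ, hφ, hφM, hφ0⟩ := h.exists_nonneg ha hb (g := fun φ => -ℓ (trigMoment k φ)) hq'
      one_pos (fun ε _ _ => by
        rw [show 2 * (k + 1) = (2 * k + 1) + 1 by ring, coeff_add, coeff_C_mul, coeff_mul_X,
          coeff_eq_zero_of_natDegree_lt (Nat.lt_succ_of_le hq.neg.1), mul_zero, add_zero]
        exact h.lead)
    have := hu _ (subset_convexHull ℝ K ⟨φ, ⟨hφ, hφM⟩, rfl⟩)
    rw [map_smul, smul_eq_mul] at this
    linarith
  obtain ⟨ι, hι, z, w, hzK, hind, hw, hw1, hwz⟩ := eq_pos_convex_span_of_mem_convexHull hmem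
  have hex : ∀ i, ∃ φ, φ ∈ A ∧ f φ • trigMoment k φ = z i := fun i => hzK ⟨i, rfl⟩
  choose y hyA hyz using hex
  have hyinj : Function.Injective y := by
    intro i j hij
    apply hind.injective
    rw [← hyz, ← hyz, hij]
  obtain ⟨N, hNdef⟩ : ∃ N, N = Fintype.card ι := ⟨_, rfl⟩
  have hN : N ≤ 2 * k + 2 := by
    have h1 := hind.card_le_finrank_succ
    have h2 : Module.finrank ℝ (vectorSpan ℝ (Set.range z)) ≤ Module.finrank ℝ (ℝ × (Fin k → ℂ)) :=
      Submodule.finrank_le _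
    have h3 : Module.finrank ℝ (ℝ × (Fin k → ℂ)) = 1 + k * 2 := by
      rw [Module.finrank_prod, Module.finrank_self, Module.finrank_pi_fintype]
      simp [Complex.finrank_real_complex]
    omega
  have hN0 : 0 < N := by
    rw [hNdef, Fintype.card_pos_iff]
    by_contra hemp
    rw [not_nonempty_iff] at hemp
    simp at hw1
  let e : Fin N ≃ ι := (Fintype.equivFinOfCardEq hNdef.symm).symm
  let σ := (Tuple.sort (y ∘ e)).trans e
  have hmono : StrictMono (y ∘ σ) :=
    (Tuple.monotone_sort (y ∘ e)).strictMono_of_injective (hyinj.comp σ.injective)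
  have hIoo : ∀ i, (y ∘ σ) i ∈ Set.Ioo (-Real.pi) Real.pi := fun i => hAIoo _ (hyA _)
  have hquad : ∀ g q, TrigRep (2 * k) g q →
      ∑ i : Fin N, (w (σ i) * f (y (σ i))) * g ((y ∘ σ) i) = 0 := by
    intro g q hg
    have h1 : ∑ i, (w i * f (y i)) • trigMoment k (y i) = 0 := by
      rw [← hwz]
      exact Finset.sum_congr rfl fun i _ => by rw [mul_smul, hyz]
    have h2 := TrigRep.sum_eq_zero_of_moment h1 hg
    rw [← Equiv.sum_comp σ] at h2
    exact h2
  obtain ⟨hNeq, halt⟩ := quadrature_alternating hN hN0 hmono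
    (fun i j => by linarith [(hIoo i).1, (hIoo j).2])
    (fun i => mul_ne_zero (hw _).ne' (hfA _ (hyA _))) hquad
  obtain ⟨ε, hε⟩ := isAlternating_of_mul_neg (a := a) (b := b) (M := M) hmono
    (fun i => (hyA _).2) (fun i j hij => by
      have h1 := halt i j hij
      have h2 := mul_pos (hw (σ i)) (hw (σ j))
      by_contra hcon
      have := mul_nonneg h2.le (not_lt.1 hcon)
      simp only [Function.comp] at this
      linarith)
  subst hNeq
  exact ⟨ε, y ∘ σ, hε, hIoo⟩

namespace IsAlternating

variable {a b : ℝ} {f : ℝ → ℝ} {M ε : ℝ} {N : ℕ} {x : Fin N → ℝ}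

theorem block (h : IsAlternating a b f M ε x) (s L : ℕ) (hL : s + L ≤ N) :
    IsAlternating a b f M (ε * (-1) ^ s) (fun i : Fin L => x ⟨s + i, by omega⟩) where
  strictMono i j hij := h.strictMono (by rw [Fin.lt_def] at hij ⊢; simp only; omega)
  sq_eq := by rw [mul_pow, h.sq_eq, ← pow_mul, mul_comm s, pow_mul]; simp
  eq i := by rw [h.eq]; simp only; rw [pow_add]; ring

theorem neg (h : IsAlternating a b f M ε x) : IsAlternating a b (fun φ => -f φ) M (-ε) x where
  strictMono := h.strictMono
  sq_eq := by rw [neg_sq, h.sq_eq]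
  eq i := by linear_combination -h.eq i

theorem comp_neg (h : IsAlternating a b f M ε x) :
    IsAlternating a b (fun φ => f (-φ)) M (ε * (-1) ^ (N - 1)) (fun i => -x (Fin.rev i)) where
  strictMono i j hij := by
    have : x (Fin.rev j) < x (Fin.rev i) := h.strictMono (Fin.rev_lt_rev.2 hij)
    simpa using this
  sq_eq := by rw [mul_pow, h.sq_eq, ← pow_mul, mul_comm (N - 1), pow_mul]; simp
  eq i := by
    simp only [neg_neg]
    rw [jacobiWeight_neg, h.eq]
    have h1 : N - 1 = (Fin.rev i : ℕ) + i := by rw [Fin.val_rev]; omega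
    rw [h1, pow_add]
    have h2 : ((-1 : ℝ) ^ (i : ℕ)) * (-1) ^ (i : ℕ) = 1 := by rw [← mul_pow]; simp
    linear_combination (-ε * (-1) ^ (Fin.rev i : ℕ) * M) * h2

theorem abs_eq (h : IsAlternating a b f M ε x) (hM : 0 ≤ M) (i : Fin N) :
    |jacobiWeight a b (x i) * f (x i)| = M := by
  have : |ε| = 1 := by rcases sq_eq_one_iff.1 h.sq_eq with h1 | h1 <;> simp [h1]
  rw [h.eq, abs_mul, abs_mul, abs_of_nonneg hM, this]; simp

/-- At an alternation point, the sign of `f` dominates that of any function with smaller weighted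
norm. -/
theorem nonneg_sub (h : IsAlternating a b f M ε x) {g : ℝ → ℝ} (i : Fin N)
    (hg : |jacobiWeight a b (x i) * g (x i)| ≤ M) (hs : Real.sin (x i) ≠ 0) :
    0 ≤ ε * (-1) ^ (i : ℕ) * (f (x i) - g (x i)) := by
  have hw := jacobiWeight_pos (a := a) (b := b) hs
  set t := ε * (-1) ^ (i : ℕ) with ht
  have ht2 : t ^ 2 = 1 := by
    rw [ht, mul_pow, h.sq_eq, ← pow_mul, mul_comm (i : ℕ), pow_mul]; simp
  have h1 : 0 ≤ jacobiWeight a b (x i) * (t * (f (x i) - g (x i))) := by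
    have h2 := h.eq i
    rw [← ht] at h2
    have h3 : jacobiWeight a b (x i) * (t * (f (x i) - g (x i))) =
        M - t * (jacobiWeight a b (x i) * g (x i)) := by
      linear_combination t * h2 + M * ht2
    rw [h3]
    have h4 := abs_le.1 hg
    rcases sq_eq_one_iff.1 ht2 with h5 | h5 <;> rw [h5] <;> linarith
  exact nonneg_of_mul_nonneg_right h1 hw

end IsAlternating

/-- The difference f(φ) - f(-φ) alternates weakly at the given points and, being odd, at their
reflections with the pattern continuing across 0. These are 2n + 2 points for level 2n, so it
vanishes. -/
theorem TrigRep.even_of_alternating {a b : ℝ} {n : ℕ} {f : ℝ → ℝ} {p : ℂ[X]} {M ε : ℝ}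
    (hf : TrigRep (2 * n) f p) (hM : ∀ φ, |jacobiWeight a b φ * f φ| ≤ M) {x : Fin (n + 1) → ℝ}
    (hx : IsAlternating a b f M ε x) (hpos : ∀ i, x i ∈ Set.Ioo 0 Real.pi) (φ : ℝ) :
    f (-φ) = f φ := by
  have hD := hf.sub hf.comp_neg
  set D : ℝ → ℝ := fun φ => f φ - f (-φ) with hDdef
  let y : Fin (2 * n + 2) → ℝ := fun j =>
    if h : (j : ℕ) < n + 1 then -x ⟨n - j, by omega⟩ else x ⟨j - (n + 1), by omega⟩
  have hy1 : ∀ j : Fin (2 * n + 2), ∀ h : (j : ℕ) < n + 1, y j = -x ⟨n - j, by omega⟩ :=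
    fun j h => dif_pos h
  have hy2 : ∀ j : Fin (2 * n + 2), ∀ h : ¬ (j : ℕ) < n + 1, y j = x ⟨j - (n + 1), by omega⟩ :=
    fun j h => dif_neg h
  have hymono : StrictMono y := by
    intro i j hij
    have hij' : (i : ℕ) < j := hij
    by_cases hj : (j : ℕ) < n + 1
    · rw [hy1 i (by omega), hy1 j hj]
      have : x ⟨n - j, by omega⟩ < x ⟨n - i, by omega⟩ :=
        hx.strictMono (by rw [Fin.lt_def]; simp only; omega)
      linarith
    · rw [hy2 j hj]
      by_cases hi : (i : ℕ) < n + 1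
      · rw [hy1 i hi]
        linarith [(hpos ⟨n - i, by omega⟩).1, (hpos ⟨j - (n + 1), by omega⟩).1]
      · rw [hy2 i hi]
        exact hx.strictMono (by rw [Fin.lt_def]; simp only; omega)
  have hyIoo : ∀ j, y j ∈ Set.Ioo (-Real.pi) Real.pi := by
    intro j
    have hpi := Real.pi_pos
    by_cases hj : (j : ℕ) < n + 1
    · rw [hy1 j hj]
      constructor <;> linarith [(hpos ⟨n - j, by omega⟩).1, (hpos ⟨n - j, by omega⟩).2]
    · rw [hy2 j hj]
      constructor <;> linarith [(hpos ⟨j - (n + 1), by omega⟩).1, (hpos ⟨j - (n + 1), by omega⟩).2]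
  have hsign : ∀ i : Fin (n + 1), 0 ≤ ε * (-1) ^ (i : ℕ) * D (x i) := by
    intro i
    refine hx.nonneg_sub (g := fun φ => f (-φ)) i ?_ ?_
    · have := hM (-x i)
      rwa [jacobiWeight_neg] at this
    · exact (Real.sin_pos_of_mem_Ioo (hpos i)).ne'
  have hε : ε ≠ 0 := by rintro rfl; have := hx.sq_eq; norm_num at this
  have hzero := hD.eq_zero_of_alternating hymono
    (fun i j => by linarith [(hyIoo i).1, (hyIoo j).2])
    (ε := ε * (-1) ^ (n + 1)) (mul_ne_zero hε (by positivity)) (by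
      intro j
      by_cases hj : (j : ℕ) < n + 1
      · rw [hy1 j hj]
        have h1 := hsign ⟨n - j, by omega⟩
        have h2 : D (-x ⟨n - j, by omega⟩) = -D (x ⟨n - j, by omega⟩) := by
          simp only [hDdef, neg_neg]; ring
        rw [h2]
        refine h1.trans_eq ?_
        simp only
        have h3 : ((-1 : ℝ) ^ (j : ℕ)) * (-1) ^ (j : ℕ) = 1 := by rw [← mul_pow]; simp
        have h4 : (-1 : ℝ) ^ (n + 1) = -((-1) ^ (n - j : ℕ) * (-1) ^ (j : ℕ)) := by
          rw [← pow_add, pow_succ, show n - (j : ℕ) + j = n by omega]; ring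
        rw [h4]
        linear_combination -(ε * (-1) ^ (n - j : ℕ) * D (x ⟨n - j, by omega⟩)) * h3
      · rw [hy2 j hj]
        have h1 := hsign ⟨j - (n + 1), by omega⟩
        refine h1.trans_eq ?_
        simp only
        have h3 : ((-1 : ℝ) ^ (n + 1)) * (-1) ^ (n + 1) = 1 := by rw [← mul_pow]; simp
        have h4 : (-1 : ℝ) ^ (j : ℕ) = (-1) ^ (j - (n + 1) : ℕ) * (-1) ^ (n + 1) := by
          rw [← pow_add]; congr 1; omega
        rw [h4]
        linear_combination -(ε * (-1) ^ (j - (n + 1) : ℕ) * D (x ⟨j - (n + 1), by omega⟩)) * h3)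
  rw [hzero] at hD
  have := hD.eq_zero_of_poly φ
  simp only [hDdef] at this
  linarith

theorem TrigRep.coeff_reflect_lead {m : ℕ} {f : ℝ → ℝ} {p : ℂ[X]} (hf : TrigRep m f p) :
    (p.reflect m).coeff m = (starRingEnd ℂ) (p.coeff m) := by
  rw [hf.reflect_eq, coeff_map]

theorem IsExtremal.comp_neg {a b : ℝ} {n : ℕ} {Λ : Set ℂ} {f : ℝ → ℝ} {p : ℂ[X]} {M : ℝ}
    (h : IsExtremal a b n Λ f p M) (hΛ : ∀ z ∈ Λ, (starRingEnd ℂ) z ∈ Λ) :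
    IsExtremal a b n Λ (fun φ => f (-φ)) (p.reflect (2 * n)) M where
  rep := h.rep.comp_neg
  lead := by rw [h.rep.coeff_reflect_lead]; exact hΛ _ h.lead
  pos := h.pos
  bound φ := by have := h.bound (-φ); rwa [jacobiWeight_neg] at this
  le := h.le

theorem TrigRep.exists_lead {n : ℕ} (hn : 0 < n) (c : ℂ) :
    ∃ f p, TrigRep (2 * n) f p ∧ p.coeff (2 * n) = c := by
  have hd : (C c * X ^ (2 * n) + C ((starRingEnd ℂ) c)).natDegree ≤ 2 * n :=
    (natDegree_add_le _ _).trans (max_le (natDegree_C_mul_X_pow_le _ _) (by simp))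
  refine ⟨_, _, TrigRep.of_reflect_eq hd ?_, ?_⟩
  · rw [reflect_add, reflect_C_mul_X_pow, reflect_C, revAt_le le_rfl]
    simp [add_comm]
  · have : 2 * n ≠ 0 := by omega
    simp [coeff_C, this]

/-- An odd extremal trigonometric polynomial with `n` alternation points in `(0, π)`. -/
theorem exists_odd_extremal {a b : ℝ} (ha : 0 < a) (hb : 0 < b) {n : ℕ} (hn : 0 < n) :
    ∃ f p M ε, ∃ x : Fin n → ℝ, TrigRep (2 * n) f p ∧ 0 < M ∧
      (∀ φ, |jacobiWeight a b φ * f φ| ≤ M) ∧ (∀ φ, f (-φ) = -f φ) ∧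
      IsAlternating a b f M ε x ∧ ∀ i, x i ∈ Set.Ioo 0 Real.pi := by
  obtain ⟨f₀, p₀, hf₀, hp₀⟩ := TrigRep.exists_lead hn Complex.I
  obtain ⟨f, p, M, h⟩ := TrigRep.exists_isExtremal ha hb n (Λ := {z | 1 ≤ z.im})
    (isClosed_le continuous_const Complex.continuous_im) (by simp) hf₀ (by simp [hp₀])
  -- Taking the odd part keeps the imaginary part of the top coefficient and does not raise the
  -- weighted norm, so the odd part is extremal too.
  have h1 := (h.rep.sub h.rep.comp_neg).smul (1 / 2)
  set g : ℝ → ℝ := fun φ => 1 / 2 * (f φ - f (-φ)) with hg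
  have hodd : ∀ φ, g (-φ) = -g φ := fun φ => by simp only [hg, neg_neg]; ring
  have hlead : (C ((1 / 2 : ℝ) : ℂ) * (p - p.reflect (2 * n))).coeff (2 * n) =
      ((p.coeff (2 * n)).im : ℂ) * Complex.I := by
    rw [coeff_C_mul, coeff_sub, h.rep.coeff_reflect_lead, Complex.sub_conj]
    push_cast; ring
  have hext : IsExtremal a b n {z | 1 ≤ z.im} g (C ((1 / 2 : ℝ) : ℂ) * (p - p.reflect (2 * n))) M :=
    { rep := h1
      lead := by rw [hlead]; simpa using h.lead
      pos := h.pos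
      bound := fun φ => by
        have h2 := abs_le.1 (h.bound φ)
        have h3 := abs_le.1 (h.bound (-φ))
        rw [jacobiWeight_neg] at h3
        simp only [hg]
        rw [abs_le]
        constructor <;> linarith
      le := h.le }
  obtain ⟨k, rfl⟩ : ∃ k, n = k + 1 := ⟨n - 1, by omega⟩
  obtain ⟨ε, x, hx, hxI⟩ := hext.exists_isAlternating ha hb (by
    intro h0
    have := hext.lead
    rw [h0] at this
    simp only [Set.mem_ofPred_eq, Complex.zero_im] at this
    linarith)
  have hx0 : ∀ i, x i ≠ 0 := by
    intro i h0
    have := hext.sin_ne_zero ha hb (hx.abs_eq h.pos.le i)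
    rw [h0] at this
    simp at this
  -- Either the first n or the last n of the 2n points lie on one side of 0; in the former case
  -- oddness reflects them.
  rcases lt_or_gt_of_ne (hx0 ⟨k + 1, by omega⟩) with hneg | hpos
  · have h2 := (hx.block 0 (k + 1) (by omega)).comp_neg.neg
    have h4 : (fun φ => -g (-φ)) = g := funext fun φ => by rw [hodd φ, neg_neg]
    rw [h4] at h2
    refine ⟨g, _, M, _, _, h1, h.pos, hext.bound, hodd, h2, ?_⟩
    · intro i
      have h3 : x ⟨0 + (Fin.rev i : ℕ), by omega⟩ < x ⟨k + 1, by omega⟩ :=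
        hx.strictMono (by rw [Fin.lt_def]; simp only; omega)
      exact ⟨by linarith, by linarith [(hxI ⟨0 + (Fin.rev i : ℕ), by omega⟩).1]⟩
  · refine ⟨g, _, M, _, _, h1, h.pos, hext.bound, hodd, hx.block (k + 1) (k + 1) (by omega), ?_⟩
    intro i
    have h3 : x ⟨k + 1, by omega⟩ ≤ x ⟨k + 1 + i, by omega⟩ :=
      hx.strictMono.monotone (by rw [Fin.le_def]; simp only; omega)
    exact ⟨by linarith, (hxI _).2⟩

/-- A trigonometric polynomial cannot have `n` alternation points in `(-π, 0)` together with the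
following signs at `0` and `π`. -/
theorem TrigRep.false_of_alternating {a b : ℝ} (ha : 0 < a) (hb : 0 < b) {n : ℕ} (hn : 0 < n)
    {f : ℝ → ℝ} {p : ℂ[X]} {M ε : ℝ} (hf : TrigRep (2 * n) f p) (hM0 : 0 < M)
    (hM : ∀ φ, |jacobiWeight a b φ * f φ| ≤ M) {l : Fin n → ℝ} (hl : IsAlternating a b f M ε l)
    (hlI : ∀ i, l i ∈ Set.Ioo (-Real.pi) 0) (h0 : 0 < ε * (-1) ^ n * f 0)
    (hpi : ε * f Real.pi ≤ 0) : False := by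
  obtain ⟨Q, q, K, δ, u, hQ, hK0, hK, hodd, hu, huI⟩ := exists_odd_extremal ha hb hn
  have hQ0 : Q 0 = 0 := by have := hodd 0; rw [neg_zero] at this; linarith
  have hQpi : Q Real.pi = 0 := by
    have h1 := hodd Real.pi
    have h2 := hQ.periodic (-Real.pi)
    rw [show -Real.pi + 2 * Real.pi = Real.pi by ring] at h2
    linarith
  have hπ := Real.pi_pos
  have hsq : ∀ k : ℕ, ((-1 : ℝ) ^ k) * (-1) ^ k = 1 := fun k => by rw [← mul_pow]; simp
  -- The sign s fits the alternation of Q on (0, π) to that of f on (-π, 0). In D = sMQ - Kf the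
  -- term Kf decides the sign at the points `l i` and the term MQ at the points `u i`; at 0 and π
  -- the odd Q vanishes and the sign comes from `h0` and `hpi`. This makes 2n + 2 alternations for
  -- level 2n.
  set s := δ * (ε * (-1) ^ n) with hs
  have hs2 : s ^ 2 = 1 := by
    rw [hs]; linear_combination (ε ^ 2 * ((-1) ^ n) ^ 2) * hu.sq_eq + ((-1) ^ n) ^ 2 * hl.sq_eq + hsq n
  have hsabs : |s| = 1 := by rcases sq_eq_one_iff.1 hs2 with h1 | h1 <;> simp [h1]
  have hD := (hQ.smul (s * M)).sub (hf.smul K)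
  set D : ℝ → ℝ := fun φ => s * M * Q φ - K * f φ with hDdef
  let y : Fin (2 * n + 2) → ℝ := fun j =>
    if h : (j : ℕ) < n then l ⟨j, h⟩ else if (j : ℕ) = n then 0 else
      if h : (j : ℕ) < 2 * n + 1 then u ⟨j - (n + 1), by omega⟩ else Real.pi
  have hcases : ∀ j : Fin (2 * n + 2),
      (∃ h : (j : ℕ) < n, y j = l ⟨j, h⟩) ∨ ((j : ℕ) = n ∧ y j = 0) ∨
      (∃ i : Fin n, (j : ℕ) = n + 1 + i ∧ y j = u i) ∨ ((j : ℕ) = 2 * n + 1 ∧ y j = Real.pi) := by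
    intro j
    by_cases h1 : (j : ℕ) < n
    · exact Or.inl ⟨h1, dif_pos h1⟩
    by_cases h2 : (j : ℕ) = n
    · exact Or.inr (Or.inl ⟨h2, by simp only [y]; rw [dif_neg h1, if_pos h2]⟩)
    by_cases h3 : (j : ℕ) < 2 * n + 1
    · exact Or.inr (Or.inr (Or.inl ⟨⟨j - (n + 1), by omega⟩, by simp only; omega,
        by simp only [y]; rw [dif_neg h1, if_neg h2, dif_pos h3]⟩))
    · exact Or.inr (Or.inr (Or.inr ⟨by omega, by simp only [y]; rw [dif_neg h1, if_neg h2, dif_neg h3]⟩))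
  have hymono : StrictMono y := by
    intro i j hij
    have hij' : (i : ℕ) < j := hij
    rcases hcases i with ⟨hi, ei⟩ | ⟨hi, ei⟩ | ⟨i', hi, ei⟩ | ⟨hi, ei⟩ <;>
      rcases hcases j with ⟨hj, ej⟩ | ⟨hj, ej⟩ | ⟨j', hj, ej⟩ | ⟨hj, ej⟩ <;>
      first
        | omega
        | (rw [ei, ej]
           first
            | exact hl.strictMono (by rw [Fin.lt_def]; exact hij')
            | exact hu.strictMono (by rw [Fin.lt_def]; omega)
            | linarith [(hlI ⟨i, hi⟩).2]
            | linarith [(hlI ⟨i, hi⟩).2, (huI j').1]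
            | linarith [(huI j').1]
            | exact (huI i').2
            | exact hπ)
  have hyI : ∀ j, -Real.pi < y j ∧ y j ≤ Real.pi := by
    intro j
    rcases hcases j with ⟨hj, ej⟩ | ⟨hj, ej⟩ | ⟨j', hj, ej⟩ | ⟨hj, ej⟩ <;> rw [ej]
    · exact ⟨(hlI _).1, by linarith [(hlI ⟨j, hj⟩).2]⟩
    · constructor <;> linarith
    · exact ⟨by linarith [(huI j').1], (huI _).2.le⟩
    · constructor <;> linarith
  have hε : ε ≠ 0 := by rintro rfl; have := hl.sq_eq; norm_num at this
  have hzero := hD.eq_zero_of_alternating hymono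
    (fun i j => by linarith [(hyI i).1, (hyI j).2]) (ε := -ε) (neg_ne_zero.2 hε) (by
      intro j
      rcases hcases j with ⟨hj, ej⟩ | ⟨hj, ej⟩ | ⟨i, hj, ej⟩ | ⟨hj, ej⟩ <;> rw [ej]
      · have hw := hl.nonneg_sub (g := fun φ => s * M / K * Q φ) ⟨j, hj⟩ (by
          rw [show ∀ x, jacobiWeight a b x * (s * M / K * Q x) =
            s * (M / K) * (jacobiWeight a b x * Q x) by intro x; ring, abs_mul, abs_mul, hsabs,
            one_mul, abs_of_pos (div_pos hM0 hK0), div_mul_eq_mul_div, div_le_iff₀ hK0]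
          exact mul_le_mul_of_nonneg_left (hK _) hM0.le)
          (Real.sin_neg_of_neg_of_neg_pi_lt (hlI _).2 (hlI _).1).ne
        refine (mul_nonneg hK0.le hw).trans_eq ?_
        simp only [hDdef]
        field_simp
        ring
      · rw [hj]
        simp only [hDdef, hQ0]
        nlinarith [mul_pos hK0 h0]
      · have hw := hu.nonneg_sub (g := fun φ => s * K / M * f φ) i (by
          rw [show ∀ x, jacobiWeight a b x * (s * K / M * f x) =
            s * (K / M) * (jacobiWeight a b x * f x) by intro x; ring, abs_mul, abs_mul, hsabs,
            one_mul, abs_of_pos (div_pos hK0 hM0), div_mul_eq_mul_div, div_le_iff₀ hM0]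
          exact mul_le_mul_of_nonneg_left (hM _) hK0.le)
          (Real.sin_pos_of_mem_Ioo (huI _)).ne'
        refine (mul_nonneg hM0.le hw).trans_eq ?_
        have e : -ε * (-1) ^ (j : ℕ) = s * δ * (-1) ^ (i : ℕ) := by
          rw [hj, pow_add, pow_succ, hs]
          linear_combination (-ε * (-1) ^ n * (-1) ^ (i : ℕ)) * hu.sq_eq
        rw [e]
        simp only [hDdef]
        field_simp
        linear_combination (-δ * Q (u i) * M) * hs2
      · rw [hj]
        simp only [hDdef, hQpi]
        rw [pow_succ, pow_mul]
        norm_num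
        nlinarith [mul_nonneg hK0.le (neg_nonneg.2 hpi)])
  rw [hzero] at hD
  have h1 := hD.eq_zero_of_poly 0
  simp only [hDdef, hQ0] at h1
  have : f 0 = 0 := by
    have : K * f 0 = 0 := by linarith
    exact (mul_eq_zero.1 this).resolve_left hK0.ne'
  rw [this] at h0
  simp at h0

/-! ### The critical polynomial divided by the alternation points. -/

/-- A trigonometric polynomial is divisible by the half-angle sines belonging to its zeros. -/
theorem TrigRep.factor {m k : ℕ} {f : ℝ → ℝ} {p : ℂ[X]} (hf : TrigRep (m + k) f p)
    {x : Fin m → ℝ} (hx : Function.Injective x) (hper : ∀ i j, |x i - x j| < 2 * Real.pi)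
    (hz : ∀ i, f (x i) = 0) :
    ∃ g q, TrigRep k g q ∧ (∀ φ, f φ = (∏ i, Real.sin ((φ - x i) / 2)) * g φ) ∧
      p = C (∏ i, (-Complex.I / 2 * cis (-x i / 2))) * (∏ i, (X - C (cis (x i)))) * q := by
  classical
  have hE := TrigRep.prod_sin_half Finset.univ x
  rw [Finset.card_univ, Fintype.card_fin] at hE
  set c : ℂ := ∏ i, (-Complex.I / 2 * cis (-x i / 2)) with hc
  have hc0 : c ≠ 0 := Finset.prod_ne_zero_iff.2 fun i _ => by simp [cis_ne_zero]
  set W : ℂ[X] := ∏ i, (X - C (cis (x i))) with hW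
  have hWm : W.Monic := monic_prod_of_monic _ _ fun i _ => monic_X_sub_C _
  have hWd : W.natDegree = m := by rw [hW, natDegree_prod_of_monic _ _ fun i _ => monic_X_sub_C _]; simp
  have hdvd : W ∣ p := by
    refine Finset.prod_dvd_of_coprime ?_ fun i _ => ?_
    · have hinj : Function.Injective fun i => cis (x i) := fun i j hij =>
        hx (cis_injective_of_abs_lt (hper i j) hij)
      exact fun i _ j _ hij => pairwise_coprime_X_sub_C hinj hij
    · rw [dvd_iff_isRoot, IsRoot.def]
      exact (hf.zero_iff _).1 (hz i)
  obtain ⟨q₀, hq₀⟩ := hdvd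
  set q : ℂ[X] := C c⁻¹ * q₀ with hq
  have hpq : p = C c * W * q := by
    rw [hq, hq₀]
    have : C c * C c⁻¹ = (1 : ℂ[X]) := by rw [← C_mul, mul_inv_cancel₀ hc0, C_1]
    linear_combination (-W * q₀) * this
  have hE0 : C c * W ≠ 0 := mul_ne_zero (C_ne_zero.2 hc0) hWm.ne_zero
  have hqd : q.natDegree ≤ k := by
    by_cases h0 : q = 0
    · simp [h0]
    · have h1 := hf.natDegree_le
      rw [hpq, natDegree_mul hE0 h0, natDegree_C_mul hc0, hWd] at h1
      omega
  -- The polynomial p and the product of sines are self-reciprocal; cancelling shows the same for q,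
  -- so the quotient is real.
  have hrefl : q.reflect k = q.map (starRingEnd ℂ) := by
    have h1 := hf.reflect_eq
    rw [hpq, reflect_mul _ _ hE.natDegree_le hqd, Polynomial.map_mul, hE.reflect_eq] at h1
    refine mul_left_cancel₀ ?_ h1
    rwa [Ne, Polynomial.map_eq_zero]
  have hg := TrigRep.of_reflect_eq hqd hrefl
  refine ⟨_, q, hg, ?_, hpq⟩
  have h1 := hE.mul hg
  rw [← hpq] at h1
  exact fun φ => congrFun (hf.congr_fun h1) φ

/-- Version of `TrigRep.even_of_alternating` on the lower half period. -/
theorem TrigRep.even_of_alternating' {a b : ℝ} {n : ℕ} {f : ℝ → ℝ} {p : ℂ[X]} {M ε : ℝ}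
    (hf : TrigRep (2 * n) f p) (hM : ∀ φ, |jacobiWeight a b φ * f φ| ≤ M) {x : Fin (n + 1) → ℝ}
    (hx : IsAlternating a b f M ε x) (hneg : ∀ i, x i ∈ Set.Ioo (-Real.pi) 0) (φ : ℝ) :
    f (-φ) = f φ := by
  have := hf.comp_neg.even_of_alternating (a := a) (b := b)
    (fun φ => by have := hM (-φ); rwa [jacobiWeight_neg] at this) hx.comp_neg
    (fun i => ⟨by linarith [(hneg (Fin.rev i)).2], by linarith [(hneg (Fin.rev i)).1]⟩) φ
  rw [neg_neg] at this
  exact this.symm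

namespace IsExtremal

variable {a b : ℝ} {n : ℕ} {Λ : Set ℂ} {f : ℝ → ℝ} {p : ℂ[X]} {M ε : ℝ} {x : Fin (2 * n) → ℝ}

/-- `n` alternation points on each half period force a sign condition at `0` and `π`. -/
theorem false_of_sign (ha : 0 < a) (hb : 0 < b) (hn : 0 < n) (h : IsExtremal a b n Λ f p M)
    (hx : IsAlternating a b f M ε x) (hxI : ∀ i, x i ∈ Set.Ioo (-Real.pi) Real.pi)
    (hlow : ∀ i : Fin (2 * n), (i : ℕ) < n → x i < 0)
    (hup : ∀ i : Fin (2 * n), n ≤ (i : ℕ) → 0 < x i)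
    (hs : (-1) ^ n * (f 0 * f Real.pi) < 0) : False := by
  have hε : ε ≠ 0 := by rintro rfl; have := hx.sq_eq; norm_num at this
  have hprod : (ε * (-1) ^ n * f 0) * (ε * f Real.pi) < 0 := by
    have : (ε * (-1) ^ n * f 0) * (ε * f Real.pi) = (-1) ^ n * (f 0 * f Real.pi) := by
      linear_combination ((-1) ^ n * (f 0 * f Real.pi)) * hx.sq_eq
    rwa [this]
  -- The two sign patterns are mirror images: the second case applies the same comparison to f(-φ).
  rcases mul_neg_iff.1 hprod with ⟨h1, h2⟩ | ⟨h1, h2⟩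
  · have hb' := hx.block 0 n (by omega)
    rw [pow_zero, mul_one] at hb'
    refine h.rep.false_of_alternating ha hb hn h.pos h.bound hb' (fun i => ⟨(hxI _).1, ?_⟩) h1 h2.le
    exact hlow _ (by simp)
  · have hb' := hx.comp_neg.block 0 n (by omega)
    have hsgn : ε * (-1) ^ (2 * n - 1) * (-1) ^ 0 = -ε := by
      obtain ⟨k, rfl⟩ : ∃ k, n = k + 1 := ⟨n - 1, by omega⟩
      rw [show 2 * (k + 1) - 1 = 2 * k + 1 by omega, pow_succ, pow_mul]; norm_num
    rw [hsgn] at hb'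
    have hpi : f (-Real.pi) = f Real.pi := by
      have := h.rep.periodic (-Real.pi)
      rw [show -Real.pi + 2 * Real.pi = Real.pi by ring] at this
      exact this.symm
    refine h.rep.comp_neg.false_of_alternating ha hb hn h.pos
      (fun φ => by have := h.bound (-φ); rwa [jacobiWeight_neg] at this) hb' (fun i => ⟨?_, ?_⟩)
      (by rw [neg_zero]; linarith) (by rw [hpi]; linarith)
    · linarith [(hxI (Fin.rev ⟨0 + i, by omega⟩)).2]
    · have := hup (Fin.rev ⟨0 + (i : ℕ), by omega⟩) (by rw [Fin.val_rev]; simp only; omega)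
      linarith

/-- The critical function divided by the half-angle sines of the alternation points. -/
theorem exists_quotient (ha : 0 < a) (hb : 0 < b) (h : IsExtremal a b n Λ f p M)
    (hx : IsAlternating a b f M ε x) (hxI : ∀ i, x i ∈ Set.Ioo (-Real.pi) Real.pi)
    {f' : ℝ → ℝ} {p' : ℂ[X]} (hf' : TrigRep (2 * n) f' p')
    (hl : p'.coeff (2 * n) = Complex.I * n * p.coeff (2 * n)) (hd : ∀ φ, HasDerivAt f (f' φ) φ) :
    ∃ g q, TrigRep 2 g q ∧
      (∀ φ, Real.sin φ * f' φ + ((a + b) * Real.cos φ + (a - b)) * f φ =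
        (∏ i, Real.sin ((φ - x i) / 2)) * g φ) ∧
      ((n + a + b : ℝ) / 2 : ℂ) * p.coeff (2 * n) =
        (∏ i, (-Complex.I / 2 * cis (-x i / 2))) * q.coeff 2 := by
  obtain ⟨P, hP, hPl⟩ := h.rep.critical hf' hl a b
  obtain ⟨g, q, hg, hY, hPq⟩ := hP.factor hx.strictMono.injective
    (fun i j => by rw [abs_lt]; constructor <;> linarith [(hxI i).1, (hxI i).2, (hxI j).1, (hxI j).2])
    (fun i => h.critical_eq_zero ha hb hd (hx.abs_eq h.pos.le i))
  refine ⟨g, q, hg, hY, ?_⟩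
  have hWm : (∏ i, (X - C (cis (x i)))).Monic := monic_prod_of_monic _ _ fun i _ => monic_X_sub_C _
  have hWd : (∏ i, (X - C (cis (x i)))).natDegree = 2 * n := by
    rw [natDegree_prod_of_monic _ _ fun i _ => monic_X_sub_C _]; simp
  rw [← hPl, hPq, mul_assoc, coeff_C_mul, coeff_mul_add_eq_of_natDegree_le hWd.le hg.natDegree_le]
  have : (∏ i, (X - C (cis (x i)))).coeff (2 * n) = 1 := by
    have := hWm.coeff_natDegree
    rwa [hWd] at this
  rw [this, one_mul]

/-- At 0 and π the derivative term drops out and the left side of `hY` becomes 2a·f(0) and -2b·f(π).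
The product of half-angle sines has sign (-1)^n at 0, from the n positive nodes, and is positive at
π. -/
theorem sign_of_quotient (ha : 0 < a) (hb : 0 < b)
    (hxI : ∀ i, x i ∈ Set.Ioo (-Real.pi) Real.pi)
    (hlow : ∀ i : Fin (2 * n), (i : ℕ) < n → x i < 0)
    (hup : ∀ i : Fin (2 * n), n ≤ (i : ℕ) → 0 < x i)
    {f f' g : ℝ → ℝ} (hY : ∀ φ, Real.sin φ * f' φ + ((a + b) * Real.cos φ + (a - b)) * f φ =
        (∏ i, Real.sin ((φ - x i) / 2)) * g φ) (hg : 0 < g 0 * g Real.pi) :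
    (-1) ^ n * (f 0 * f Real.pi) < 0 := by
  have h0 := hY 0
  have hpi := hY Real.pi
  simp only [Real.sin_zero, Real.cos_zero, Real.sin_pi, Real.cos_pi, zero_mul, zero_add] at h0 hpi
  have hE0 : 0 < (-1) ^ n * ∏ i, Real.sin ((0 - x i) / 2) := by
    have hsplit : ∀ F : Fin (2 * n) → ℝ, ∏ i, F i =
        (∏ i : Fin n, F ⟨i, by omega⟩) * ∏ i : Fin n, F ⟨n + i, by omega⟩ := by
      intro F
      rw [← Fin.prod_congr' F (show n + n = 2 * n by omega), Fin.prod_univ_add]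
      rfl
    rw [hsplit]
    have e : (-1 : ℝ) ^ n = ∏ i : Fin n, (-1 : ℝ) := by simp
    rw [mul_left_comm, e, ← Finset.prod_mul_distrib]
    refine mul_pos (Finset.prod_pos fun i _ => ?_) (Finset.prod_pos fun i _ => ?_)
    · have h1 := hlow ⟨i, by omega⟩ i.2
      have h2 := (hxI ⟨i, by omega⟩).1
      exact Real.sin_pos_of_pos_of_lt_pi (by linarith) (by linarith)
    · have h1 := hup ⟨n + i, by omega⟩ (by simp)
      have h2 := (hxI ⟨n + i, by omega⟩).2
      have := Real.sin_neg_of_neg_of_neg_pi_lt (x := (0 - x ⟨n + i, by omega⟩) / 2)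
        (by linarith) (by linarith)
      linarith
  have hEpi : 0 < ∏ i, Real.sin ((Real.pi - x i) / 2) := by
    refine Finset.prod_pos fun i _ => ?_
    have := hxI i
    exact Real.sin_pos_of_pos_of_lt_pi (by linarith [this.2]) (by linarith [this.1])
  have key : (-1) ^ n * (f 0 * f Real.pi) * (4 * a * b) =
      -(((-1) ^ n * ∏ i, Real.sin ((0 - x i) / 2)) * (∏ i, Real.sin ((Real.pi - x i) / 2)) *
        (g 0 * g Real.pi)) := by
    linear_combination (-1) ^ n * (-2 * b * f Real.pi) * (-1) * h0 -
      (-1) ^ n * ((∏ i, Real.sin ((0 - x i) / 2)) * g 0) * hpi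
  have h4 : 0 < ((-1) ^ n * ∏ i, Real.sin ((0 - x i) / 2)) *
    (∏ i, Real.sin ((Real.pi - x i) / 2)) * (g 0 * g Real.pi) := mul_pos (mul_pos hE0 hEpi) hg
  have h5 : 0 < 4 * a * b := by positivity
  by_contra hcon
  have := mul_nonneg (not_lt.1 hcon) h5.le
  linarith

end IsExtremal

/-! ### Extremal points outside the alternation set. -/

namespace IsAlternating

variable {a b : ℝ} {f : ℝ → ℝ} {M ε : ℝ}

theorem cons {n : ℕ} {u : Fin (n + 1) → ℝ} (hu : IsAlternating a b f M ε u) {ψ : ℝ}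
    (hψ : jacobiWeight a b ψ * f ψ = -ε * M) (hlt : ψ < u 0) :
    IsAlternating a b f M (-ε) (Fin.cons ψ u : Fin (n + 2) → ℝ) where
  strictMono := by
    rw [Fin.strictMono_iff_lt_succ]
    intro i
    refine Fin.cases ?_ (fun i => ?_) i
    · simpa using hlt
    · rw [← Fin.succ_castSucc, Fin.cons_succ, Fin.cons_succ]
      exact hu.strictMono Fin.castSucc_lt_succ
  sq_eq := by rw [neg_sq, hu.sq_eq]
  eq i := by
    refine Fin.cases ?_ (fun i => ?_) i
    · simpa using hψ
    · rw [Fin.cons_succ, hu.eq, Fin.val_succ, pow_succ]; ring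

theorem snoc {n : ℕ} {u : Fin (n + 1) → ℝ} (hu : IsAlternating a b f M ε u) {ψ : ℝ}
    (hψ : jacobiWeight a b ψ * f ψ = ε * (-1) ^ (n + 1) * M) (hlt : u (Fin.last n) < ψ) :
    IsAlternating a b f M ε (Fin.snoc u ψ : Fin (n + 2) → ℝ) where
  strictMono := by
    rw [Fin.strictMono_iff_lt_succ]
    intro i
    refine Fin.lastCases ?_ (fun i => ?_) i
    · simpa using hlt
    · rw [Fin.succ_castSucc, Fin.snoc_castSucc, Fin.snoc_castSucc]
      exact hu.strictMono Fin.castSucc_lt_succ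
  sq_eq := hu.sq_eq
  eq i := by
    refine Fin.lastCases ?_ (fun i => ?_) i
    · simpa using hψ
    · rw [Fin.snoc_castSucc, hu.eq, Fin.val_castSucc]

/-- A further extremal point either extends the alternation or has an adjacent alternation point
with the same value. -/
theorem extend {n : ℕ} {u : Fin (n + 1) → ℝ} (hu : IsAlternating a b f M ε u) {ψ : ℝ}
    {I : Set ℝ} (huI : ∀ i, u i ∈ I) (hψI : ψ ∈ I)
    (hψ : |jacobiWeight a b ψ * f ψ| = M) (hne : ∀ i, u i ≠ ψ) :
    (∃ δ, ∃ v : Fin (n + 2) → ℝ, IsAlternating a b f M δ v ∧ ∀ i, v i ∈ I) ∨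
      ∃ i, jacobiWeight a b ψ * f ψ = jacobiWeight a b (u i) * f (u i) ∧
        ∀ j, u j ≤ min ψ (u i) ∨ max ψ (u i) ≤ u j := by
  have hsign : ∀ t : ℝ, t ^ 2 = 1 →
      jacobiWeight a b ψ * f ψ = t * M ∨ jacobiWeight a b ψ * f ψ = -t * M := by
    intro t ht
    rcases eq_or_eq_neg_of_abs_eq hψ with h1 | h1 <;> rcases sq_eq_one_iff.1 ht with rfl | rfl <;>
      rw [h1] <;> simp
  have hsq : ∀ i : ℕ, (ε * (-1) ^ i) ^ 2 = 1 := fun i => by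
    rw [mul_pow, hu.sq_eq, ← pow_mul, mul_comm i, pow_mul]; simp
  by_cases hall : ∀ j, u j < ψ
  · rcases hsign _ (hsq n) with h1 | h1
    · refine Or.inr ⟨Fin.last n, by rw [hu.eq, h1]; simp, fun j => Or.inl ?_⟩
      rw [min_eq_right (hall _).le]
      exact hu.strictMono.monotone (Fin.le_last j)
    · refine Or.inl ⟨_, _, hu.snoc (ψ := ψ) (by rw [h1, pow_succ]; ring) (hall _), fun i => ?_⟩
      refine Fin.lastCases ?_ (fun i => ?_) i
      · simpa using hψI
      · simpa using huI i
  · have hex : ∃ j : ℕ, ∃ h : j < n + 1, ψ < u ⟨j, h⟩ := by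
      push Not at hall
      obtain ⟨j, hj⟩ := hall
      exact ⟨j, j.2, lt_of_le_of_ne hj (hne j).symm⟩
    classical
    obtain ⟨hj, hψj⟩ := Nat.find_spec hex
    have hmin : ∀ i : Fin (n + 1), (i : ℕ) < Nat.find hex → u i < ψ := by
      intro i hi
      have := Nat.find_min hex hi
      push Not at this
      exact lt_of_le_of_ne (this i.2) (hne i)
    set j := Nat.find hex with hjdef
    have hge : ∀ i : Fin (n + 1), j ≤ (i : ℕ) → u ⟨j, hj⟩ ≤ u i := fun i hi =>
      hu.strictMono.monotone (by rw [Fin.le_def]; exact hi)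
    rcases hsign _ (hsq j) with h1 | h1
    · refine Or.inr ⟨⟨j, hj⟩, by rw [hu.eq, h1], fun i => ?_⟩
      rw [min_eq_left hψj.le, max_eq_right hψj.le]
      rcases Nat.lt_or_ge i j with hi | hi
      · exact Or.inl (hmin i hi).le
      · exact Or.inr (hge i hi)
    · rcases Nat.eq_zero_or_pos j with h0 | h0
      · have e0 : (⟨j, hj⟩ : Fin (n + 1)) = 0 := Fin.ext h0
        rw [h0, pow_zero, mul_one] at h1
        rw [e0] at hψj
        refine Or.inl ⟨_, _, hu.cons (ψ := ψ) h1 hψj, fun i => ?_⟩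
        refine Fin.cases ?_ (fun i => ?_) i
        · simpa using hψI
        · simpa using huI i
      · have hlt := hmin ⟨j - 1, by omega⟩ (by simp only; omega)
        refine Or.inr ⟨⟨j - 1, by omega⟩, ?_, fun i => ?_⟩
        · rw [hu.eq, h1]
          have : (-1 : ℝ) ^ j = (-1) ^ (j - 1) * (-1) := by rw [← pow_succ]; congr 1; omega
          rw [this]; ring
        · rw [min_eq_right hlt.le, max_eq_left hlt.le]
          rcases Nat.lt_or_ge i j with hi | hi
          · exact Or.inl (hu.strictMono.monotone (by rw [Fin.le_def]; simp only; omega))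
          · exact Or.inr (hψj.le.trans (hge i hi))

end IsAlternating

namespace IsExtremal

variable {a b : ℝ} {n : ℕ} {Λ : Set ℂ} {f : ℝ → ℝ} {p : ℂ[X]} {M ε : ℝ} {x : Fin (2 * n) → ℝ}

/-- An extremal point in `(0, π)` outside an alternation set balanced between the two half periods
forces evenness. -/
theorem even_of_extra (ha : 0 < a) (hb : 0 < b) (hn : 0 < n) (h : IsExtremal a b n Λ f p M)
    (h0 : p.coeff (2 * n) ≠ 0)
    (hx : IsAlternating a b f M ε x) (hxI : ∀ i, x i ∈ Set.Ioo (-Real.pi) Real.pi)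
    (hlow : ∀ i : Fin (2 * n), (i : ℕ) < n → x i < 0)
    (hup : ∀ i : Fin (2 * n), n ≤ (i : ℕ) → 0 < x i) {ψ : ℝ} (hψI : ψ ∈ Set.Ioo 0 Real.pi)
    (hψ : |jacobiWeight a b ψ * f ψ| = M) (hne : ∀ i, x i ≠ ψ) (φ : ℝ) : f (-φ) = f φ := by
  obtain ⟨f', p', hf', hl, hd⟩ := h.rep.hasDerivAt_lead
  obtain ⟨g, q, hg, hY, hlead⟩ := h.exists_quotient ha hb hx hxI hf' hl hd
  obtain ⟨k, rfl⟩ : ∃ k, n = k + 1 := ⟨n - 1, by omega⟩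
  have hu := hx.block (k + 1) (k + 1) (by omega)
  have huI : ∀ i : Fin (k + 1), x ⟨k + 1 + i, by omega⟩ ∈ Set.Ioo 0 Real.pi := fun i =>
    ⟨hup _ (by simp), (hxI _).2⟩
  -- Either ψ yields n + 1 alternation points in (0, π), or w f takes the same value at ψ and at an
  -- adjacent alternation point; Rolle's theorem then gives one more critical point y between them.
  rcases hu.extend huI hψI hψ (fun i => hne _) with ⟨δ, v, hv, hvI⟩ | ⟨i, hSi, hbtw⟩
  · exact h.rep.even_of_alternating h.bound hv hvI φ
  exfalso
  set y₀ := x ⟨k + 1 + i, by omega⟩ with hy₀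
  have hy₀I : y₀ ∈ Set.Ioo 0 Real.pi := huI i
  have hlt : min ψ y₀ < max ψ y₀ := min_lt_max.2 (hne _).symm
  have hsub : ∀ t ∈ Set.Icc (min ψ y₀) (max ψ y₀), t ∈ Set.Ioo 0 Real.pi := fun t ht =>
    ⟨(lt_min hψI.1 hy₀I.1).trans_le ht.1, ht.2.trans_lt (max_lt hψI.2 hy₀I.2)⟩
  have hder : ∀ t ∈ Set.Icc (min ψ y₀) (max ψ y₀), HasDerivAt _ _ t := fun t ht =>
    hasDerivAt_weight_mul (a := a) (b := b) (Real.sin_pos_of_mem_Ioo (hsub t ht)).ne' (hd t)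
  obtain ⟨y, hyI, hy⟩ := exists_hasDerivAt_eq_zero hlt
    (fun t ht => (hder t ht).continuousAt.continuousWithinAt)
    (by rcases le_total ψ y₀ with h1 | h1
        · rw [min_eq_left h1, max_eq_right h1]; exact hSi
        · rw [min_eq_right h1, max_eq_left h1]; exact hSi.symm)
    (fun t ht => hder t (Set.Ioo_subset_Icc_self ht))
  have hyI' := hsub y (Set.Ioo_subset_Icc_self hyI)
  have hsy := Real.sin_pos_of_mem_Ioo hyI'
  have hwy := jacobiWeight_pos (a := a) (b := b) hsy.ne'
  have hYy : Real.sin y * f' y + ((a + b) * Real.cos y + (a - b)) * f y = 0 := by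
    rw [div_eq_zero_iff, mul_eq_zero] at hy
    exact (hy.resolve_right hsy.ne').resolve_left hwy.ne'
  have hgzero : ∀ t ∈ Set.Ioo 0 Real.pi, (∀ i, x i ≠ t) →
      Real.sin t * f' t + ((a + b) * Real.cos t + (a - b)) * f t = 0 → g t = 0 := by
    intro t ht htx h1
    rw [hY] at h1
    refine (mul_eq_zero.1 h1).resolve_left (Finset.prod_ne_zero_iff.2 fun j _ => ?_)
    rw [Ne, Real.sin_eq_zero_iff_of_lt_of_lt]
    · intro h2; exact htx j (by linarith)
    · linarith [ht.1, (hxI j).2, Real.pi_pos]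
    · linarith [ht.2, (hxI j).1, Real.pi_pos]
  have hgψ : g ψ = 0 := hgzero ψ hψI hne (h.critical_eq_zero ha hb hd hψ)
  have hgy : g y = 0 := by
    refine hgzero y hyI' (fun j hj => ?_) hYy
    rcases Nat.lt_or_ge j (k + 1) with h1 | h1
    · have := hlow j h1
      rw [hj] at this
      exact absurd hyI'.1 this.not_gt
    · have h2 := hbtw ⟨j - (k + 1), by omega⟩
      have h3 : (⟨k + 1 + (j - (k + 1) : ℕ), by omega⟩ : Fin (2 * (k + 1))) = j :=
        Fin.ext (by simp only; omega)
      simp only [h3, hj] at h2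
      rcases h2 with h2 | h2
      · exact absurd hyI.1 h2.not_gt
      · exact absurd hyI.2 h2.not_gt
  have hψy : ψ ≠ y := by
    rintro rfl
    rcases le_total ψ y₀ with h1 | h1
    · have := hyI.1; rw [min_eq_left h1] at this; exact lt_irrefl _ this
    · have := hyI.2; rw [max_eq_left h1] at this; exact lt_irrefl _ this
  have hq0 : q ≠ 0 := by
    rintro rfl
    rw [coeff_zero, mul_zero] at hlead
    have : (((k + 1 : ℕ) + a + b : ℝ) : ℂ) ≠ 0 := by
      have : (0 : ℝ) < (k + 1 : ℕ) + a + b := by positivity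
      exact_mod_cast this.ne'
    exact mul_ne_zero (div_ne_zero (by exact_mod_cast this) two_ne_zero) h0 hlead
  -- A nonzero g of level 2 has at most two zeros per period. These are ψ and y, so g keeps one sign
  -- on [-π, 0], and g(-π) = g(π).
  have hgne : ∀ z ∈ Set.Icc (-Real.pi) 0, g z ≠ 0 := by
    intro z hz hgz
    refine hq0 (hg.eq_zero_of_zeros {ψ, y, z} ?_ ?_ ?_)
    · rw [Finset.card_eq_three.2 ⟨ψ, y, z, hψy, ?_, ?_, rfl⟩]
      · norm_num
      · rintro rfl; exact absurd hψI.1 hz.2.not_gt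
      · rintro rfl; exact absurd hyI'.1 hz.2.not_gt
    · have key : ∀ t ∈ ({ψ, y, z} : Finset ℝ), -Real.pi ≤ t ∧ t < Real.pi := by
        intro t ht
        have hpi := Real.pi_pos
        simp only [Finset.mem_insert, Finset.mem_singleton] at ht
        rcases ht with rfl | rfl | rfl
        · exact ⟨by linarith [hψI.1], hψI.2⟩
        · exact ⟨by linarith [hyI'.1], hyI'.2⟩
        · exact ⟨hz.1, by linarith [hz.2]⟩
      intro s hs t ht
      rw [abs_lt]
      constructor <;> linarith [(key s hs).1, (key s hs).2, (key t ht).1, (key t ht).2]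
    · intro t ht
      simp only [Finset.mem_insert, Finset.mem_singleton] at ht
      rcases ht with rfl | rfl | rfl <;> assumption
  have hpi0 := Real.pi_pos
  have hgpi : g (-Real.pi) = g Real.pi := by
    have := TrigRep.periodic (n := 1) hg (-Real.pi)
    rw [show -Real.pi + 2 * Real.pi = Real.pi by ring] at this
    exact this.symm
  have hpos : 0 < g 0 * g Real.pi := by
    rw [← hgpi]
    have h1 := hgne 0 ⟨by linarith, le_rfl⟩
    have h2 := hgne (-Real.pi) ⟨le_rfl, by linarith⟩
    by_contra hcon
    have hcon' : g 0 * g (-Real.pi) < 0 := lt_of_le_of_ne (not_lt.1 hcon) (mul_ne_zero h1 h2)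
    have hle : -Real.pi ≤ 0 := by linarith
    rcases mul_neg_iff.1 hcon' with ⟨h3, h4⟩ | ⟨h3, h4⟩
    · obtain ⟨z, hz, hz0⟩ := intermediate_value_Icc hle hg.continuous.continuousOn ⟨h4.le, h3.le⟩
      exact hgne z hz hz0
    · obtain ⟨z, hz, hz0⟩ := intermediate_value_Icc' hle hg.continuous.continuousOn ⟨h3.le, h4.le⟩
      exact hgne z hz hz0
  exact h.false_of_sign ha hb hn hx hxI hlow hup
    (sign_of_quotient ha hb hxI hlow hup hY hpos)

end IsExtremal

/-! ### Second-order perturbation. -/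

open Filter Topology in
/-- Second order bound for the perturbation of a function near a maximum of its weighted value. -/
theorem eventually_perturbation_le {a b u M : ℝ} (ha : 0 < a) (hb : 0 < b) (hu : 0 < u)
    {f F F' : ℝ → ℝ} (hfc : Continuous f) (hF'c : Continuous F')
    (hF : ∀ φ, HasDerivAt F (F' φ) φ)
    (hS : ∀ φ, Real.sin φ ≠ 0 → HasDerivAt (fun t => jacobiWeight a b t * f t)
      (-u * (jacobiWeight a b φ * F φ)) φ)
    (hM : ∀ φ, jacobiWeight a b φ * f φ ≤ M)
    (hsin : ∀ φ, jacobiWeight a b φ * f φ = M → Real.sin φ ≠ 0)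
    (hiso : ∀ φ, ∀ᶠ t in 𝓝[≠] φ, F t ≠ 0) {η : ℝ} (hη : 0 < η) (φ₀ : ℝ) :
    ∀ᶠ z : ℝ × ℝ in 𝓝 (0, φ₀),
      jacobiWeight a b z.2 * (f z.2 + z.1 * F z.2 - z.1 ^ 2 / (2 * u) * F' z.2) ≤
        M + η * z.1 ^ 2 := by
  have hwc := continuous_jacobiWeight ha hb
  have hFc : Continuous F := continuous_iff_continuousAt.2 fun φ => (hF φ).continuousAt
  rcases (hM φ₀).lt_or_eq with hlt | heq
  · have h1 : Continuous fun z : ℝ × ℝ =>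
        jacobiWeight a b z.2 * (f z.2 + z.1 * F z.2 - z.1 ^ 2 / (2 * u) * F' z.2) := by fun_prop
    have h2 : Continuous fun z : ℝ × ℝ => M + η * z.1 ^ 2 := by fun_prop
    refine (h1.continuousAt.eventually_lt h2.continuousAt (x₀ := (0, φ₀)) ?_).mono
      fun z hz => hz.le
    simpa using hlt
  -- Heuristically, with γ = z.1, s = z.2 - φ₀ and e = w(φ₀)F'(φ₀), the left side is M - (eu/2)(s -
  -- γ/u)² to second order: the peak is merely shifted. As e may vanish, the estimate below avoids
  -- Taylor expansion.
  have hs₀ := hsin φ₀ heq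
  have hw₀ := jacobiWeight_pos (a := a) (b := b) hs₀
  have hF₀ : F φ₀ = 0 := by
    have hmax : IsLocalMax (fun t => jacobiWeight a b t * f t) φ₀ :=
      Eventually.of_forall fun t => by simp only; rw [heq]; exact hM t
    have h1 := hmax.hasDerivAt_eq_zero (hS φ₀ hs₀)
    have h2 := (mul_eq_zero.1 h1).resolve_left (neg_ne_zero.2 hu.ne')
    exact (mul_eq_zero.1 h2).resolve_left hw₀.ne'
  set X : ℝ → ℝ := fun t => jacobiWeight a b t * F t with hX
  set X' : ℝ → ℝ := fun t =>
    jacobiWeight a b t * (Real.sin t * F' t + ((a + b) * Real.cos t + (a - b)) * F t) / Real.sin t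
    with hX'
  have hXd : ∀ t, Real.sin t ≠ 0 → HasDerivAt X (X' t) t := fun t ht =>
    hasDerivAt_weight_mul ht (hF t)
  set e := jacobiWeight a b φ₀ * F' φ₀ with he
  have hX'₀ : X' φ₀ = e := by simp only [hX', hF₀, he]; field_simp; ring
  -- Chosen so that the final error 2·(γ²/(2u))·δ equals ηγ².
  set δ := u * η with hδ
  have hδ0 : 0 < δ := mul_pos hu hη
  have hX'c : ContinuousAt X' φ₀ := by
    have h1 : Continuous fun t => jacobiWeight a b t *
      (Real.sin t * F' t + ((a + b) * Real.cos t + (a - b)) * F t) := by fun_prop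
    exact h1.continuousAt.div Real.continuous_sin.continuousAt hs₀
  have hwF' : ContinuousAt (fun t => jacobiWeight a b t * F' t) φ₀ := (hwc.mul hF'c).continuousAt
  have ev : ∀ᶠ t in 𝓝 φ₀, Real.sin t ≠ 0 ∧ X' t < e + δ ∧ e - δ < jacobiWeight a b t * F' t ∧
      (t ≠ φ₀ → F t ≠ 0) := by
    refine (Real.continuous_sin.continuousAt.eventually_ne hs₀).and
      ((hX'c.eventually_lt continuousAt_const (by rw [hX'₀]; linarith)).and
      ((continuousAt_const.eventually_lt hwF' (by linarith)).and ?_))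
    exact eventually_nhdsWithin_iff.1 (hiso φ₀)
  obtain ⟨d, hd0, hd⟩ := Metric.eventually_nhds_iff_ball.1 ev
  have hball : ∀ s ∈ Metric.ball φ₀ d, ∀ t ∈ Metric.ball φ₀ d, Set.Icc s t ⊆ Metric.ball φ₀ d :=
    fun s hs t ht => (convex_ball φ₀ d).ordConnected.out hs ht
  -- Cauchy's mean value theorem for (wF)² against w f. Both derivatives contain the factor wF,
  -- which is nonzero off φ₀ and cancels.
  have hcauchy : ∀ s ∈ Metric.ball φ₀ d, ∀ t ∈ Metric.ball φ₀ d, s < t → (s = φ₀ ∨ t = φ₀) →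
      ∃ c, c < e + δ ∧ (jacobiWeight a b t * f t - jacobiWeight a b s * f s) * (2 * c) =
        -u * (X t ^ 2 - X s ^ 2) := by
    intro s hs t ht hst hor
    have hsub := hball s hs t ht
    have hd1 : ∀ r ∈ Set.Icc s t, HasDerivAt (fun r => X r ^ 2) (2 * X r * X' r) r := by
      intro r hr
      refine ((hXd r (hd r (hsub hr)).1).pow 2).congr_deriv ?_
      simp
    have hd2 : ∀ r ∈ Set.Icc s t, HasDerivAt (fun t => jacobiWeight a b t * f t) (-u * X r) r :=
      fun r hr => hS r (hd r (hsub hr)).1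
    obtain ⟨c, hc, hcE⟩ := exists_ratio_hasDerivAt_eq_ratio_slope _ _ hst
      (fun r hr => (hd1 r hr).continuousAt.continuousWithinAt)
      (fun r hr => hd1 r (Set.Ioo_subset_Icc_self hr)) _ _
      (fun r hr => (hd2 r hr).continuousAt.continuousWithinAt)
      (fun r hr => hd2 r (Set.Ioo_subset_Icc_self hr))
    have hcb := hd c (hsub (Set.Ioo_subset_Icc_self hc))
    have hcne : c ≠ φ₀ := by
      rcases hor with rfl | rfl
      · exact hc.1.ne'
      · exact hc.2.ne
    refine ⟨X' c, hcb.2.1, ?_⟩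
    have hXc : X c ≠ 0 :=
      mul_ne_zero (jacobiWeight_pos (a := a) (b := b) hcb.1).ne' (hcb.2.2.2 hcne)
    apply mul_right_cancel₀ hXc
    linear_combination hcE
  have hX₀ : X φ₀ = 0 := by simp [hX, hF₀]
  have hkey : ∀ t ∈ Metric.ball φ₀ d,
      u * X t ^ 2 ≤ 2 * (M - jacobiWeight a b t * f t) * (e + δ) := by
    intro t ht
    have hA := hM t
    rcases lt_trichotomy t φ₀ with h1 | h1 | h1
    · obtain ⟨c, hc, hE⟩ := hcauchy t ht φ₀ (Metric.mem_ball_self hd0) h1 (Or.inr rfl)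
      rw [heq, hX₀] at hE
      have := mul_le_mul_of_nonneg_left hc.le (sub_nonneg.2 hA)
      nlinarith
    · rw [h1, heq, hX₀]; simp
    · obtain ⟨c, hc, hE⟩ := hcauchy φ₀ (Metric.mem_ball_self hd0) t ht h1 (Or.inl rfl)
      rw [heq, hX₀] at hE
      have := mul_le_mul_of_nonneg_left hc.le (sub_nonneg.2 hA)
      nlinarith
  have hc0 : 0 < e + δ := by
    have hmem : φ₀ + d / 2 ∈ Metric.ball φ₀ d := by
      rw [Metric.mem_ball, Real.dist_eq, add_sub_cancel_left, abs_of_pos (by linarith)]; linarith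
    have h1 := hkey _ hmem
    have h2 := hd _ hmem
    have h3 : X (φ₀ + d / 2) ≠ 0 :=
      mul_ne_zero (jacobiWeight_pos (a := a) (b := b) h2.1).ne' (h2.2.2.2 (by linarith))
    have h4 : 0 < u * X (φ₀ + d / 2) ^ 2 := by positivity
    have h5 := hM (φ₀ + d / 2)
    by_contra hcon
    have := mul_nonneg (sub_nonneg.2 h5) (neg_nonneg.2 (not_lt.1 hcon))
    linarith
  have hall : ∀ᶠ t in 𝓝 φ₀, ∀ γ : ℝ,
      jacobiWeight a b t * (f t + γ * F t - γ ^ 2 / (2 * u) * F' t) ≤ M + η * γ ^ 2 := by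
    filter_upwards [Metric.ball_mem_nhds φ₀ hd0] with t ht γ
    have h1 := hkey t ht
    have h2 := (hd t ht).2.2.1
    set A := M - jacobiWeight a b t * f t with hA
    have hA0 : 0 ≤ A := sub_nonneg.2 (hM t)
    set D := γ ^ 2 / (2 * u) with hD
    have hD0 : 0 ≤ D := by positivity
    have hDu : γ ^ 2 = 2 * u * D := by rw [hD]; field_simp
    -- By the inequality of arithmetic and geometric means, γX is at most A + D(e + δ), where A is
    -- the gap below M; that gap then absorbs the first-order term.
    have h3 : (γ * X t) ^ 2 ≤ (A + D * (e + δ)) ^ 2 := by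
      have h4 : (γ * X t) ^ 2 ≤ 4 * A * (D * (e + δ)) := by
        rw [mul_pow, hDu]
        have := mul_le_mul_of_nonneg_left h1 (mul_nonneg two_pos.le hD0)
        linarith
      nlinarith [sq_nonneg (A - D * (e + δ))]
    have h5 := (abs_le.1 (abs_le_of_sq_le_sq h3 (add_nonneg hA0 (mul_nonneg hD0 hc0.le)))).2
    have h6 := mul_le_mul_of_nonneg_left h2.le hD0
    have h7 : jacobiWeight a b t * (f t + γ * F t - D * F' t) =
        M - A + γ * X t - D * (jacobiWeight a b t * F' t) := by simp only [hA, hX]; ring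
    rw [h7, hDu]
    have h8 : η * (2 * u * D) = 2 * (D * δ) := by rw [hδ]; ring
    rw [h8]
    linarith
  have htend : Tendsto (fun z : ℝ × ℝ => z.2) (𝓝 (0, φ₀)) (𝓝 φ₀) := continuous_snd.tendsto _
  exact (htend.eventually hall).mono fun z hz => hz z.1

open Filter Topology in
theorem TrigRep.eventually_ne_zero {m : ℕ} {f : ℝ → ℝ} {p : ℂ[X]} (hf : TrigRep m f p)
    (hp : p ≠ 0) (φ : ℝ) : ∀ᶠ t in 𝓝[≠] φ, f t ≠ 0 := by
  set Z := {t ∈ Metric.ball φ Real.pi | f t = 0} with hZ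
  have hfin : Z.Finite := by
    refine Set.Finite.of_finite_image (f := cis) ((p.finite_setOfPred_isRoot hp).subset ?_) ?_
    · rintro _ ⟨t, ⟨_, ht⟩, rfl⟩
      exact (hf.zero_iff t).1 ht
    · intro s hs t ht hst
      refine cis_injective_of_abs_lt ?_ hst
      have h1 := abs_lt.1 (Real.dist_eq s φ ▸ Metric.mem_ball.1 hs.1)
      have h2 := abs_lt.1 (Real.dist_eq t φ ▸ Metric.mem_ball.1 ht.1)
      rw [abs_lt]; constructor <;> linarith [h1.1, h1.2, h2.1, h2.2]
  have h1 : ∀ᶠ t in 𝓝 φ, t ∉ Z \ {φ} :=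
    (hfin.subset Set.sdiff_subset).isClosed.isOpen_compl.mem_nhds (by simp)
  rw [eventually_nhdsWithin_iff]
  filter_upwards [h1, Metric.ball_mem_nhds φ Real.pi_pos] with t ht htb htne h0
  exact ht ⟨⟨htb, h0⟩, htne⟩

theorem TrigRep.eq_add_sin {g : ℝ → ℝ} {q : ℂ[X]} (hg : TrigRep 2 g q) {s : ℝ}
    (hq : q.coeff 2 = -Complex.I / 2 * s) (φ : ℝ) : g φ = g 0 + s * Real.sin φ := by
  obtain ⟨r, hr⟩ := TrigRep.lower (m := 0) (hg.sub (TrigRep.sin.smul s)) (by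
    rw [zero_add, coeff_sub, hq, coeff_C_mul, coeff_C_mul, coeff_sub, coeff_X_pow]
    simp [coeff_one]; ring)
  have h1 : ∀ t, ((g t - s * Real.sin t : ℝ) : ℂ) = r.coeff 0 := by
    intro t
    have h2 := hr.eval_cis t
    have hd := hr.natDegree_le
    rw [eq_C_of_natDegree_le_zero hd] at h2
    simpa [cis_zero] using h2
  have h2 : g φ - s * Real.sin φ = g 0 - s * Real.sin 0 := by
    exact_mod_cast (h1 φ).trans (h1 0).symm
  rw [Real.sin_zero] at h2
  linarith

namespace IsExtremal

variable {a b : ℝ} {n : ℕ} {f : ℝ → ℝ} {p : ℂ[X]} {M : ℝ}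

/-- If E increased the modulus of the top coefficient to first order, E - δf with small δ > 0 would
still be admissible, while decreasing |f| at every extremal point, against Kolmogorov's criterion.
-/
theorem not_pos_re (ha : 0 < a) (hb : 0 < b) (h : IsExtremal a b n {z | 1 ≤ ‖z‖} f p M)
    {E : ℝ → ℝ} {e : ℂ[X]} (hE : TrigRep (2 * n) E e)
    (hz : ∀ φ ∈ Set.Icc (-Real.pi) Real.pi, |jacobiWeight a b φ * f φ| = M → E φ = 0) :
    ¬ 0 < ((starRingEnd ℂ) (p.coeff (2 * n)) * e.coeff (2 * n)).re := by
  intro hpos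
  set A := p.coeff (2 * n) with hA
  set B := e.coeff (2 * n) with hB
  have hA1 : 1 ≤ ‖A‖ := h.lead
  have hnorm : ∀ z : ℂ, 1 ≤ ‖z‖ ↔ 1 ≤ z.re ^ 2 + z.im ^ 2 := by
    intro z
    rw [← one_le_sq_iff₀ (norm_nonneg z), ← Complex.normSq_eq_norm_sq, Complex.normSq_apply, sq, sq]
  have hA2 := (hnorm A).1 hA1
  set c := A.re * B.re + A.im * B.im with hc
  have hc0 : 0 < c := by simpa [hc] using hpos
  set K := A.re ^ 2 + A.im ^ 2 with hK
  have hK0 : 0 < K := by linarith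
  -- This spends half of the first-order gain: the squared modulus still grows by εc to first order.
  set δ := c / (2 * K) with hδ
  have hδ0 : 0 < δ := by positivity
  have hδK : 2 * K * δ = c := by rw [hδ]; field_simp
  have hg := hE.sub (h.rep.smul δ)
  obtain ⟨φ, hφ, hφM, hφ0⟩ := h.exists_nonneg ha hb hg (ε₀ := 1 / (2 * δ)) (by positivity) (by
    intro ε hε0 hε
    rw [lt_div_iff₀ (by positivity)] at hε
    change 1 ≤ ‖_‖
    rw [coeff_add, coeff_C_mul, coeff_sub, coeff_C_mul, ← hA, ← hB, hnorm]
    simp only [Complex.add_re, Complex.add_im, Complex.re_ofReal_mul, Complex.im_ofReal_mul,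
      Complex.sub_re, Complex.sub_im]
    have e1 : (A.re + ε * (B.re - δ * A.re)) ^ 2 + (A.im + ε * (B.im - δ * A.im)) ^ 2 =
        K + ε * c * (1 - ε * (2 * δ)) + ε ^ 2 * δ ^ 2 * K + ε ^ 2 * (B.re ^ 2 + B.im ^ 2) := by
      rw [hc, hK] at *
      linear_combination -ε * hδK
    rw [e1]
    have h1 : 0 ≤ ε * c * (1 - ε * (2 * δ)) := by
      have : 0 ≤ 1 - ε * (2 * δ) := by linarith
      positivity
    have h2 : 0 ≤ ε ^ 2 * δ ^ 2 * K := by positivity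
    have h3 : 0 ≤ ε ^ 2 * (B.re ^ 2 + B.im ^ 2) := by positivity
    linarith)
  rw [hz φ hφ hφM] at hφ0
  have hf0 : f φ ≠ 0 := by
    intro h0
    rw [h0, mul_zero, abs_zero] at hφM
    exact h.pos.ne hφM
  have : 0 < δ * (f φ * f φ) := mul_pos hδ0 (mul_self_pos.2 hf0)
  linarith

/-- The leading coefficient of a trigonometric polynomial vanishing at the extremal points is
orthogonal to that of the extremal one. -/
theorem re_lead_eq_zero (ha : 0 < a) (hb : 0 < b) (h : IsExtremal a b n {z | 1 ≤ ‖z‖} f p M)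
    {E : ℝ → ℝ} {e : ℂ[X]} (hE : TrigRep (2 * n) E e)
    (hz : ∀ φ ∈ Set.Icc (-Real.pi) Real.pi, |jacobiWeight a b φ * f φ| = M → E φ = 0) :
    ((starRingEnd ℂ) (p.coeff (2 * n)) * e.coeff (2 * n)).re = 0 := by
  have h1 := h.not_pos_re ha hb hE hz
  have h2 := h.not_pos_re ha hb hE.neg (fun φ hφ hM => by rw [hz φ hφ hM, neg_zero])
  rw [coeff_neg, mul_neg, Complex.neg_re] at h2
  linarith

open Filter Topology in
/-- The derivative of the weighted extremal function is not a multiple of a weighted trigonometric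
polynomial with rotated leading coefficient. -/
theorem false_of_derivative (ha : 0 < a) (hb : 0 < b)
    (h : IsExtremal a b n {z | 1 ≤ ‖z‖} f p M) {F : ℝ → ℝ} {P : ℂ[X]} (hF : TrigRep (2 * n) F P)
    (hP : P.coeff (2 * n) = -Complex.I * p.coeff (2 * n)) {u : ℝ} (hu : n < u)
    (hS : ∀ φ, Real.sin φ ≠ 0 → HasDerivAt (fun t => jacobiWeight a b t * f t)
      (-u * (jacobiWeight a b φ * F φ)) φ) : False := by
  obtain ⟨F', P', hF', hP', hFd⟩ := hF.hasDerivAt_lead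
  have hu0 : 0 < u := (Nat.cast_nonneg n).trans_lt hu
  have hpc0 : p.coeff (2 * n) ≠ 0 := by
    intro h0
    have : 1 ≤ ‖p.coeff (2 * n)‖ := h.lead
    rw [h0, norm_zero] at this
    linarith
  have hPne : P ≠ 0 := by
    rintro rfl
    rw [coeff_zero] at hP
    exact mul_ne_zero (neg_ne_zero.2 Complex.I_ne_zero) hpc0 hP.symm
  -- The top coefficient of the perturbed polynomial is 1 - γ²n/(2u) - iγ times the old one, so its
  -- squared modulus is at least 1 + κγ².
  set κ := 1 - n / u with hκ
  have hκ0 : 0 < κ := by rw [hκ, sub_pos, div_lt_one hu0]; exact hu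
  have hκ1 : κ ≤ 1 := by rw [hκ]; have : (0 : ℝ) ≤ n / u := by positivity
                         linarith
  have hM0 := h.pos
  -- Small enough that the squared norm bound (M + ηγ²)² stays below M²(1 + κγ²) for γ < 1.
  set η := κ * M / 4 with hη
  have hη0 : 0 < η := by positivity
  have e1 := fun φ₀ => eventually_perturbation_le ha hb hu0 h.rep.continuous hF'.continuous hFd hS
    (fun φ => (abs_le.1 (h.bound φ)).2)
    (fun φ hφ => h.sin_ne_zero ha hb (by rw [hφ, abs_of_pos hM0]))
    (hF.eventually_ne_zero hPne) hη0 φ₀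
  have e2 := fun φ₀ => eventually_perturbation_le (f := fun φ => -f φ) (F := fun φ => -F φ)
    (F' := fun φ => -F' φ) (M := M) ha hb hu0 h.rep.neg.continuous hF'.neg.continuous
    (fun φ => (hFd φ).neg)
    (fun φ hφ => by
      have := (hS φ hφ).neg
      refine (this.congr_deriv (by ring)).congr_of_eventuallyEq (Eventually.of_forall fun t => ?_)
      simp)
    (fun φ => by have := (abs_le.1 (h.bound φ)).1; linarith)
    (fun φ hφ => h.sin_ne_zero ha hb (by
      rw [show jacobiWeight a b φ * f φ = -M by linarith, abs_neg, abs_of_pos hM0]))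
    (hF.neg.eventually_ne_zero (neg_ne_zero.2 hPne)) hη0 φ₀
  have ev := (isCompact_Icc (a := -Real.pi) (b := Real.pi)).eventually_forall_of_forall_eventually
    (x₀ := (0 : ℝ)) (P := fun γ φ =>
      |jacobiWeight a b φ * (f φ + γ * F φ - γ ^ 2 / (2 * u) * F' φ)| ≤ M + η * γ ^ 2)
    (fun φ₀ _ => by
      filter_upwards [e1 φ₀, e2 φ₀] with z h1 h2
      rw [abs_le]
      constructor <;> linarith)
  obtain ⟨d, hd0, hd⟩ := Metric.eventually_nhds_iff_ball.1 ev
  obtain ⟨γ, hγ0, hγd, hγ1⟩ : ∃ γ : ℝ, 0 < γ ∧ γ < d ∧ γ < 1 := by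
    refine ⟨min d 1 / 2, ?_, ?_, ?_⟩
    · have : 0 < min d 1 := lt_min hd0 one_pos
      linarith
    · have := min_le_left d 1
      have : 0 < min d 1 := lt_min hd0 one_pos
      linarith
    · have := min_le_right d 1
      linarith
  have hb1 := hd γ (by rw [Metric.mem_ball, Real.dist_eq, sub_zero, abs_of_pos hγ0]; exact hγd)
  have hT := (h.rep.add (hF.smul γ)).sub (hF'.smul (γ ^ 2 / (2 * u)))
  set ℓ : ℂ := ⟨1 - γ ^ 2 * n / (2 * u), -γ⟩ with hℓ
  have hlead : (p + C (γ : ℂ) * P - C ((γ ^ 2 / (2 * u) : ℝ) : ℂ) * P').coeff (2 * n) =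
      ℓ * p.coeff (2 * n) := by
    have h1 : ℓ = 1 - γ ^ 2 * n / (2 * u) - Complex.I * γ := by
      rw [hℓ, Complex.mk_eq_add_mul_I]; push_cast; ring
    rw [coeff_sub, coeff_add, coeff_C_mul, coeff_C_mul, hP', hP, h1]
    push_cast
    linear_combination (γ ^ 2 / (2 * u) * n * p.coeff (2 * n) : ℂ) * Complex.I_sq
  have hℓsq : 1 + κ * γ ^ 2 ≤ ‖ℓ‖ ^ 2 := by
    rw [← Complex.normSq_eq_norm_sq, Complex.normSq_apply]
    simp only [hℓ]
    have e3 : (1 - γ ^ 2 * n / (2 * u)) * (1 - γ ^ 2 * n / (2 * u)) + -γ * -γ =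
        1 + κ * γ ^ 2 + (γ ^ 2 * n / (2 * u)) ^ 2 := by rw [hκ]; field_simp; ring
    rw [e3]
    linarith [sq_nonneg (γ ^ 2 * n / (2 * u))]
  have hℓ0 : 0 < ‖ℓ‖ := by
    have : 0 < ‖ℓ‖ ^ 2 := lt_of_lt_of_le (by positivity) hℓsq
    exact (norm_nonneg ℓ).lt_of_ne' fun h0 => by rw [h0] at this; norm_num at this
  have hle := h.le _ _ (‖ℓ‖⁻¹ * (M + η * γ ^ 2)) (hT.smul ‖ℓ‖⁻¹) (by
    change 1 ≤ ‖_‖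
    rw [coeff_C_mul, hlead, norm_mul, norm_mul, Complex.norm_real, norm_inv, norm_norm,
      inv_mul_cancel_left₀ hℓ0.ne']
    exact h.lead) (by
    have hper := hT.periodic
    refine forall_of_periodic (fun φ => by
      have h1 := hper φ
      simp only at h1 ⊢
      rw [h1, jacobiWeight_periodic]) fun φ hφ => ?_
    rw [mul_left_comm, abs_mul, abs_of_pos (inv_pos.2 hℓ0)]
    exact mul_le_mul_of_nonneg_left (hb1 φ hφ) (inv_pos.2 hℓ0).le)
  rw [inv_mul_eq_div, le_div_iff₀ hℓ0] at hle
  have h5 : M ^ 2 * (1 + κ * γ ^ 2) ≤ (M + η * γ ^ 2) ^ 2 :=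
    calc M ^ 2 * (1 + κ * γ ^ 2) ≤ M ^ 2 * ‖ℓ‖ ^ 2 := by gcongr
      _ = (M * ‖ℓ‖) ^ 2 := by ring
      _ ≤ _ := by gcongr
  have hγ2 : 0 < γ ^ 2 := by positivity
  have hγ21 : γ ^ 2 ≤ 1 := by nlinarith
  have h6 : (M + η * γ ^ 2) ^ 2 = M ^ 2 + (κ * M ^ 2 * γ ^ 2) * (1 / 2 + κ * γ ^ 2 / 16) := by
    rw [hη]; ring
  have h7 : 0 < κ * M ^ 2 * γ ^ 2 := by positivity
  have h8 : κ * γ ^ 2 ≤ 1 := mul_le_one₀ hκ1 hγ2.le hγ21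
  rw [h6] at h5
  nlinarith

/-! ### Evenness of the extremal polynomials. -/

/-- Extremal trigonometric polynomials with leading coefficient of modulus at least one are even. -/
theorem even (ha : 0 < a) (hb : 0 < b) (hn : 0 < n) (h : IsExtremal a b n {z | 1 ≤ ‖z‖} f p M)
    (φ : ℝ) : f (-φ) = f φ := by
  obtain ⟨k, rfl⟩ : ∃ k, n = k + 1 := ⟨n - 1, by omega⟩
  have h0 : p.coeff (2 * (k + 1)) ≠ 0 := by
    intro h0
    have : 1 ≤ ‖p.coeff (2 * (k + 1))‖ := h.lead
    rw [h0, norm_zero] at this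
    linarith
  obtain ⟨ε, x, hx, hxI⟩ := h.exists_isAlternating ha hb h0
  have hne : ∀ ψ, |jacobiWeight a b ψ * f ψ| = M → ψ ≠ 0 := by
    rintro _ hψ rfl
    exact h.sin_ne_zero ha hb hψ Real.sin_zero
  have hx0 : ∀ i, x i ≠ 0 := fun i => hne _ (hx.abs_eq h.pos.le i)
  by_contra hodd
  -- Otherwise n + 1 alternation points lie in one half period and f is even. Hence n points lie on
  -- each side of 0.
  have hk : x ⟨k, by omega⟩ < 0 := by
    by_contra hcon
    refine hodd (h.rep.even_of_alternating h.bound (hx.block k (k + 1 + 1) (by omega)) (fun i => ?_) φ)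
    refine ⟨((not_lt.1 hcon).lt_of_ne' (hx0 _)).trans_le (hx.strictMono.monotone ?_), (hxI _).2⟩
    rw [Fin.le_def]; simp
  have hk1 : 0 < x ⟨k + 1, by omega⟩ := by
    by_contra hcon
    refine hodd (h.rep.even_of_alternating' h.bound (hx.block 0 (k + 1 + 1) (by omega))
      (fun i => ⟨(hxI _).1, ?_⟩) φ)
    refine (hx.strictMono.monotone ?_).trans_lt ((not_lt.1 hcon).lt_of_ne (hx0 _))
    rw [Fin.le_def]; simp only; omega
  have hlow : ∀ i : Fin (2 * (k + 1)), (i : ℕ) < k + 1 → x i < 0 := fun i hi =>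
    (hx.strictMono.monotone (by rw [Fin.le_def]; simp only; omega)).trans_lt hk
  have hup : ∀ i : Fin (2 * (k + 1)), k + 1 ≤ (i : ℕ) → 0 < x i := fun i hi =>
    hk1.trans_le (hx.strictMono.monotone (by rw [Fin.le_def]; exact hi))
  by_cases hex : ∃ ψ ∈ Set.Icc (-Real.pi) Real.pi, |jacobiWeight a b ψ * f ψ| = M ∧ ∀ i, x i ≠ ψ
  · obtain ⟨ψ, hψI, hψ, hψx⟩ := hex
    have hs := h.sin_ne_zero ha hb hψ
    rcases lt_or_gt_of_ne (hne ψ hψ) with hneg | hpos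
    · have hψ1 : -Real.pi < ψ := lt_of_le_of_ne hψI.1 (by rintro rfl; simp at hs)
      have := (h.comp_neg (fun z hz => by simpa using hz)).even_of_extra ha hb hn
        (by rw [h.rep.coeff_reflect_lead]; simpa using h0) hx.comp_neg
        (fun i => ⟨by linarith [(hxI (Fin.rev i)).2], by linarith [(hxI (Fin.rev i)).1]⟩)
        (fun i hi => by
          have := hup (Fin.rev i) (by rw [Fin.val_rev]; omega)
          linarith)
        (fun i hi => by
          have := hlow (Fin.rev i) (by rw [Fin.val_rev]; omega)
          linarith)
        (ψ := -ψ) ⟨by linarith, by linarith⟩ (by rwa [jacobiWeight_neg, neg_neg])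
        (fun i hi => hψx _ (neg_injective hi)) φ
      rw [neg_neg] at this
      exact hodd this.symm
    · have hψ1 : ψ < Real.pi := lt_of_le_of_ne hψI.2 (by rintro rfl; simp at hs)
      exact hodd (h.even_of_extra ha hb hn h0 hx hxI hlow hup ⟨hpos, hψ1⟩ hψ hψx φ)
  push Not at hex
  obtain ⟨f', p', hf', hl, hd⟩ := h.rep.hasDerivAt_lead
  obtain ⟨g, q, hg, hY, hlead⟩ := h.exists_quotient ha hb hx hxI hf' hl hd
  have hE := TrigRep.prod_sin_half Finset.univ x
  rw [Finset.card_univ, Fintype.card_fin] at hE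
  have hEl : (C (∏ i, (-Complex.I / 2 * cis (-x i / 2))) * ∏ i, (X - C (cis (x i)))).coeff
      (2 * (k + 1)) = ∏ i, (-Complex.I / 2 * cis (-x i / 2)) := by
    have hWm : (∏ i, (X - C (cis (x i)))).Monic := monic_prod_of_monic _ _ fun i _ => monic_X_sub_C _
    have hWd : (∏ i, (X - C (cis (x i)))).natDegree = 2 * (k + 1) := by
      rw [natDegree_prod_of_monic _ _ fun i _ => monic_X_sub_C _]; simp
    have := hWm.coeff_natDegree
    rw [hWd] at this
    rw [coeff_C_mul, this, mul_one]
  have hre := h.re_lead_eq_zero ha hb hE (fun ψ hψI hψ => by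
    obtain ⟨i, hi⟩ := hex ψ hψI hψ
    exact Finset.prod_eq_zero (Finset.mem_univ i) (by rw [hi]; simp))
  rw [hEl] at hre
  set B : ℂ := ∏ i, (-Complex.I / 2 * cis (-x i / 2)) with hB
  have hB0 : B ≠ 0 := Finset.prod_ne_zero_iff.2 fun i _ => by simp [cis_ne_zero]
  set A := p.coeff (2 * (k + 1)) with hA
  -- The extremal points are now exactly the zeros x i of the sine product, so its top coefficient B
  -- is orthogonal to A.
  obtain ⟨ρ, hρ⟩ : ∃ ρ : ℝ, B = Complex.I * ρ * A := by
    refine ⟨((starRingEnd ℂ) A * B).im / Complex.normSq A, ?_⟩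
    have h1 : (starRingEnd ℂ) A * B = Complex.I * ((starRingEnd ℂ) A * B).im := by
      apply Complex.ext <;> simp [-Complex.mul_re, -Complex.mul_im, Complex.re_mul_ofReal, Complex.im_mul_ofReal, hre]
    have h2 : ((Complex.normSq A : ℝ) : ℂ) ≠ 0 := by simpa using h0
    have h3 := Complex.normSq_eq_conj_mul_self (z := A)
    push_cast
    rw [mul_assoc, div_mul_eq_mul_div, mul_div_assoc', eq_div_iff h2, h3]
    linear_combination A * h1
  have hρ0 : ρ ≠ 0 := by rintro rfl; rw [hρ] at hB0; simp at hB0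
  have hρ0' : (ρ : ℂ) ≠ 0 := by exact_mod_cast hρ0
  set u : ℝ := (k + 1 : ℕ) + a + b with hu
  have hq2 : q.coeff 2 = -Complex.I / 2 * ((u / ρ : ℝ) : ℂ) := by
    rw [hρ] at hlead
    push_cast
    have h1 : (Complex.I * ρ * A) * q.coeff 2 = (Complex.I * ρ * A) * (-Complex.I / 2 * (u / ρ)) := by
      rw [← hlead]
      field_simp
      linear_combination (u : ℂ) * Complex.I_sq
    exact mul_left_cancel₀ (by rw [← hρ]; exact hB0) h1
  have hgs := hg.eq_add_sin hq2
  -- Here g = g(0) + (u/ρ)sin. If g(0) = 0, the factor sin cancels in the derivative of w f, leaving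
  -- -u w F with F = -E/ρ for the sine product E; otherwise g(π) = g(0) gives the excluded sign.
  rcases eq_or_ne (g 0) 0 with hg0 | hg0
  · refine h.false_of_derivative ha hb (hE.smul (-1 / ρ)) ?_ (u := u) (by rw [hu]; linarith) ?_
    · rw [coeff_C_mul, hEl, hρ]
      push_cast
      field_simp
      ring
    · intro t ht
      refine (hasDerivAt_weight_mul ht (hd t)).congr_deriv ?_
      rw [hY, hgs, hg0]
      field_simp
      ring
  · refine h.false_of_sign ha hb hn hx hxI hlow hup (sign_of_quotient ha hb hxI hlow hup hY ?_)
    rw [hgs Real.pi, Real.sin_pi, mul_zero, add_zero]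
    exact mul_self_pos.2 hg0

end IsExtremal

/-! ### Uniqueness up to sign, and zeros. -/

namespace IsExtremal

variable {a b : ℝ} {n : ℕ} {f g : ℝ → ℝ} {p q : ℂ[X]} {M K : ℝ}

/-- Otherwise rescaling the top coefficient to modulus 1 would lower the norm. -/
theorem norm_lead (h : IsExtremal a b n {z | 1 ≤ ‖z‖} f p M) : ‖p.coeff (2 * n)‖ = 1 := by
  have h1 : 1 ≤ ‖p.coeff (2 * n)‖ := h.lead
  have h0 : 0 < ‖p.coeff (2 * n)‖ := by linarith
  have h2 := h.le _ _ (‖p.coeff (2 * n)‖⁻¹ * M) (h.rep.smul ‖p.coeff (2 * n)‖⁻¹) (by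
    change 1 ≤ ‖_‖
    rw [coeff_C_mul, norm_mul, Complex.norm_real, norm_inv, norm_norm, inv_mul_cancel₀ h0.ne'])
    (fun φ => by
      rw [mul_left_comm, abs_mul, abs_of_pos (inv_pos.2 h0)]
      exact mul_le_mul_of_nonneg_left (h.bound φ) (inv_pos.2 h0).le)
  rw [inv_mul_eq_div, le_div_iff₀ h0] at h2
  have h3 := h.pos
  refine le_antisymm ?_ h1
  by_contra hcon
  nlinarith

/-- For even f the reversed polynomial is p itself, so by `coeff_reflect_lead` the top coefficient
equals its conjugate. -/
theorem lead_eq (ha : 0 < a) (hb : 0 < b) (hn : 0 < n)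
    (h : IsExtremal a b n {z | 1 ≤ ‖z‖} f p M) :
    p.coeff (2 * n) = 1 ∨ p.coeff (2 * n) = -1 := by
  have h1 : (fun φ => f (-φ)) = f := funext (h.even ha hb hn)
  have h2 := h.rep.comp_neg
  rw [h1] at h2
  have h3 := h.rep.coeff_reflect_lead
  rw [← h.rep.unique h2] at h3
  obtain ⟨r, hr⟩ := Complex.conj_eq_iff_real.1 h3.symm
  have h4 := h.norm_lead
  rw [hr, Complex.norm_real, Real.norm_eq_abs] at h4
  rw [hr]
  rcases eq_or_eq_neg_of_abs_eq h4 with rfl | rfl <;> simp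

theorem neg (h : IsExtremal a b n {z | 1 ≤ ‖z‖} f p M) :
    IsExtremal a b n {z | 1 ≤ ‖z‖} (fun φ => -f φ) (-p) M where
  rep := h.rep.neg
  lead := by
    change 1 ≤ ‖_‖
    rw [coeff_neg, norm_neg]
    exact h.lead
  pos := h.pos
  bound φ := by rw [mul_neg, abs_neg]; exact h.bound φ
  le := h.le

/-- The difference loses its top term, so it has level 2n - 2, yet its signs alternate weakly at the
2n alternation points of f. -/
theorem eq_of_lead_eq (ha : 0 < a) (hb : 0 < b) (hn : 0 < n)
    (h : IsExtremal a b n {z | 1 ≤ ‖z‖} f p M) (hg : TrigRep (2 * n) g q)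
    (hM : ∀ φ, |jacobiWeight a b φ * g φ| ≤ M) (hl : q.coeff (2 * n) = p.coeff (2 * n)) :
    g = f := by
  obtain ⟨k, rfl⟩ : ∃ k, n = k + 1 := ⟨n - 1, by omega⟩
  have h0 : p.coeff (2 * (k + 1)) ≠ 0 := by
    have := h.norm_lead
    intro h0
    rw [h0, norm_zero] at this
    norm_num at this
  obtain ⟨ε, x, hx, hxI⟩ := h.exists_isAlternating ha hb h0
  obtain ⟨r, hr⟩ := TrigRep.lower (m := 2 * k) (h.rep.sub hg) (by
    rw [coeff_sub, show 2 * k + 2 = 2 * (k + 1) by ring, hl, sub_self])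
  have hε : ε ≠ 0 := by rintro rfl; have := hx.sq_eq; norm_num at this
  have hzero := hr.eq_zero_of_alternating (x := x) hx.strictMono
    (fun i j => by linarith [(hxI i).1, (hxI j).2]) hε
    (fun i => hx.nonneg_sub i (hM _) (h.sin_ne_zero ha hb (hx.abs_eq h.pos.le i)))
  rw [hzero] at hr
  funext φ
  have := hr.eq_zero_of_poly φ
  linarith

/-- Extremal trigonometric polynomials are unique up to sign. -/
theorem abs_eq (ha : 0 < a) (hb : 0 < b) (hn : 0 < n)
    (h : IsExtremal a b n {z | 1 ≤ ‖z‖} f p M) (h' : IsExtremal a b n {z | 1 ≤ ‖z‖} g q M)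
    (φ : ℝ) : |g φ| = |f φ| := by
  by_cases hl : q.coeff (2 * n) = p.coeff (2 * n)
  · rw [h.eq_of_lead_eq ha hb hn h'.rep h'.bound hl]
  · have hl' : (-q).coeff (2 * n) = p.coeff (2 * n) := by
      rw [coeff_neg]
      rcases h.lead_eq ha hb hn with h1 | h1 <;> rcases h'.lead_eq ha hb hn with h2 | h2 <;>
        rw [h1, h2] at hl ⊢ <;> simp at hl ⊢
    rw [← h.eq_of_lead_eq ha hb hn h'.neg.rep h'.neg.bound hl', abs_neg]

/-- Extremal trigonometric polynomials have only real zeros. -/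
theorem exists_zeros (ha : 0 < a) (hb : 0 < b) (hn : 0 < n)
    (h : IsExtremal a b n {z | 1 ≤ ‖z‖} f p M) :
    ∃ t : Fin (2 * n) → ℝ, Function.Injective (fun i => cis (t i)) ∧
      ∀ φ, |f φ| = ‖∏ i, (cis φ - cis (t i))‖ := by
  obtain ⟨k, rfl⟩ : ∃ k, n = k + 1 := ⟨n - 1, by omega⟩
  have h0 : p.coeff (2 * (k + 1)) ≠ 0 := by
    have := h.norm_lead
    intro h0
    rw [h0, norm_zero] at this
    norm_num at this
  obtain ⟨ε, x, hx, hxI⟩ := h.exists_isAlternating ha hb h0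
  -- The cyclic successor of x i. As the number of points is even, the alternation continues across
  -- the end of the period and gives a zero in each of the 2n gaps.
  let y : Fin (2 * (k + 1)) → ℝ := fun i =>
    if h : (i : ℕ) + 1 < 2 * (k + 1) then x ⟨i + 1, h⟩ else x ⟨0, by omega⟩ + 2 * Real.pi
  have hylt : ∀ i j, i < j → y i ≤ x j := by
    intro i j hij
    rw [Fin.lt_def] at hij
    simp only [y]
    rw [dif_pos (by omega)]
    exact hx.strictMono.monotone (by rw [Fin.le_def]; exact hij)
  have hyle : ∀ i, y i ≤ x ⟨0, by omega⟩ + 2 * Real.pi := by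
    intro i
    simp only [y]
    split_ifs with hi
    · linarith [(hxI ⟨0, by omega⟩).1, (hxI ⟨i + 1, hi⟩).2]
    · exact le_rfl
  have hxy : ∀ i, x i < y i := by
    intro i
    simp only [y]
    split_ifs with hi
    · exact hx.strictMono (by rw [Fin.lt_def]; simp)
    · linarith [(hxI ⟨0, by omega⟩).1, (hxI i).2]
  have hsign : ∀ i : Fin (2 * (k + 1)), jacobiWeight a b (y i) * f (y i) =
      -(jacobiWeight a b (x i) * f (x i)) := by
    intro i
    simp only [y]
    split_ifs with hi
    · rw [hx.eq, hx.eq, pow_succ]; ring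
    · have hi' : (i : ℕ) = 2 * k + 1 := by omega
      rw [jacobiWeight_periodic, h.rep.periodic, hx.eq, hx.eq, hi', pow_succ, pow_mul]
      simp
  have hex : ∀ i, ∃ t ∈ Set.Ioo (x i) (y i), f t = 0 := by
    intro i
    have hneg : f (x i) * f (y i) < 0 := by
      have h1 := h.pos
      have h2 : (jacobiWeight a b (x i) * f (x i)) * (jacobiWeight a b (y i) * f (y i)) < 0 := by
        have h3 : 0 < |jacobiWeight a b (x i) * f (x i)| := by rw [hx.abs_eq h.pos.le]; exact h1
        rw [hsign, mul_neg, neg_lt_zero]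
        exact mul_self_pos.2 (abs_pos.1 h3)
      have h4 := mul_nonneg (jacobiWeight_nonneg (a := a) (b := b) (x i))
        (jacobiWeight_nonneg (a := a) (b := b) (y i))
      by_contra hcon
      have := mul_nonneg h4 (not_lt.1 hcon)
      linarith
    have hc := h.rep.continuous.continuousOn (s := Set.Icc (x i) (y i))
    rcases mul_neg_iff.1 hneg with ⟨h1, h2⟩ | ⟨h1, h2⟩
    · obtain ⟨t, ht, ht0⟩ := intermediate_value_Ioo' (hxy i).le hc ⟨h2, h1⟩
      exact ⟨t, ht, ht0⟩
    · obtain ⟨t, ht, ht0⟩ := intermediate_value_Ioo (hxy i).le hc ⟨h1, h2⟩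
      exact ⟨t, ht, ht0⟩
  choose t htI ht0 using hex
  have htmono : StrictMono t := fun i j hij =>
    ((htI i).2.trans_le (hylt i j hij)).trans (htI j).1
  have hrange : ∀ i, x ⟨0, by omega⟩ < t i ∧ t i < x ⟨0, by omega⟩ + 2 * Real.pi := fun i =>
    ⟨(hx.strictMono.monotone (by rw [Fin.le_def]; simp)).trans_lt (htI i).1,
      (htI i).2.trans_le (hyle i)⟩
  have hper : ∀ i j, |t i - t j| < 2 * Real.pi := fun i j => by
    rw [abs_lt]
    constructor <;> linarith [(hrange i).1, (hrange i).2, (hrange j).1, (hrange j).2]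
  obtain ⟨g, q, hg, -, hp⟩ := TrigRep.factor (m := 2 * (k + 1)) (k := 0) h.rep htmono.injective hper ht0
  refine ⟨t, fun i j hij => htmono.injective (cis_injective_of_abs_lt (hper i j) hij), fun φ => ?_⟩
  have hWm : (∏ i, (X - C (cis (t i)))).Monic := monic_prod_of_monic _ _ fun i _ => monic_X_sub_C _
  have hWd : (∏ i, (X - C (cis (t i)))).natDegree = 2 * (k + 1) := by
    rw [natDegree_prod_of_monic _ _ fun i _ => monic_X_sub_C _]; simp
  have hW := hWm.coeff_natDegree
  rw [hWd] at hW
  have hp' : p = C (p.coeff (2 * (k + 1))) * ∏ i, (X - C (cis (t i))) := by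
    rw [eq_C_of_natDegree_le_zero hg.natDegree_le] at hp
    have h1 : p.coeff (2 * (k + 1)) =
        (∏ i, (-Complex.I / 2 * cis (-t i / 2))) * q.coeff 0 := by
      rw [hp, coeff_mul_C, coeff_C_mul, hW, mul_one]
    rw [h1, C_mul]
    conv_lhs => rw [hp]
    ring
  have h2 : |f φ| = ‖p.eval (cis φ)‖ := by
    rw [← h.rep.eval_cis, norm_mul, norm_cis, mul_one, Complex.norm_real, Real.norm_eq_abs]
  rw [h2, hp', eval_mul, eval_C, norm_mul, h.norm_lead, one_mul, eval_prod]
  simp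

end IsExtremal

/-! ### Back to configurations of nodes. -/

/-- The trigonometric polynomial with the given nodes as zeros. -/
noncomputable def nodeFun {m : ℕ} (θ : Fin m → ℝ) (φ : ℝ) : ℝ :=
  2 ^ m * ∏ i, Real.sin ((φ - θ i) / 2)

theorem exists_trigRep_nodeFun {m : ℕ} (θ : Fin m → ℝ) :
    ∃ p, TrigRep m (nodeFun θ) p ∧ ‖p.coeff m‖ = 1 := by
  have h := TrigRep.prod_sin_half Finset.univ θ
  rw [Finset.card_univ, Fintype.card_fin] at h
  refine ⟨_, h.smul (2 ^ m), ?_⟩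
  have hWm : (∏ i, (X - C (cis (θ i)))).Monic := monic_prod_of_monic _ _ fun i _ => monic_X_sub_C _
  have hWd : (∏ i, (X - C (cis (θ i)))).natDegree = m := by
    rw [natDegree_prod_of_monic _ _ fun i _ => monic_X_sub_C _]; simp
  have hW := hWm.coeff_natDegree
  rw [hWd] at hW
  rw [coeff_C_mul, coeff_C_mul, hW, mul_one, norm_mul, norm_prod]
  simp only [norm_mul, norm_cis, norm_div, norm_neg, Complex.norm_I, mul_one, Finset.prod_const,
    Finset.card_univ, Fintype.card_fin, Complex.norm_real]
  simp

theorem abs_nodeFun {m : ℕ} (θ : Fin m → ℝ) (φ : ℝ) :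
    |nodeFun θ φ| = ‖∏ i, (cis φ - cis (θ i))‖ := by
  simp_rw [cis_sub_cis]
  rw [norm_prod, nodeFun, abs_mul, Finset.abs_prod]
  simp only [norm_mul, norm_cis, Complex.norm_I, mul_one, Complex.norm_real, Real.norm_eq_abs]
  rw [Finset.prod_mul_distrib]
  simp

/-- Since |z ∓ 1|² = 2 ∓ 2cos φ on the circle, the exponents 2a and 2b become a and b. -/
theorem nodeModulus_cis {m : ℕ} (a b : ℝ) (θ : Fin m → ℝ) (φ : ℝ) :
    nodeModulus a b θ (cis φ) = |jacobiWeight a b φ * nodeFun θ φ| := by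
  have hs := Real.sin_sq_add_cos_sq φ
  have h1 : ‖cis φ - 1‖ ^ (2 * a) = (2 - 2 * Real.cos φ) ^ a := by
    rw [Real.rpow_mul (norm_nonneg _), Real.rpow_two, ← Complex.normSq_eq_norm_sq,
      Complex.normSq_apply, cis_eq]
    congr 1
    simp only [Complex.sub_re, Complex.sub_im, Complex.add_re, Complex.add_im,
      Complex.re_ofReal_mul, Complex.im_ofReal_mul, Complex.ofReal_re, Complex.ofReal_im,
      Complex.I_re, Complex.I_im, Complex.one_re, Complex.one_im]
    linear_combination hs
  have h2 : ‖cis φ + 1‖ ^ (2 * b) = (2 + 2 * Real.cos φ) ^ b := by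
    rw [Real.rpow_mul (norm_nonneg _), Real.rpow_two, ← Complex.normSq_eq_norm_sq,
      Complex.normSq_apply, cis_eq]
    congr 1
    simp only [Complex.add_re, Complex.add_im,
      Complex.re_ofReal_mul, Complex.im_ofReal_mul, Complex.ofReal_re, Complex.ofReal_im,
      Complex.I_re, Complex.I_im, Complex.one_re, Complex.one_im]
    linear_combination hs
  rw [nodeModulus, norm_mul, norm_mul, Complex.norm_cpow_real, Complex.norm_cpow_real, h1, h2,
    abs_mul, abs_nodeFun, abs_of_nonneg (jacobiWeight_nonneg φ), jacobiWeight]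
  simp only [cis, mul_comm Complex.I]

theorem exists_cis_eq {z : ℂ} (hz : z ∈ Metric.sphere (0 : ℂ) 1) : ∃ φ, cis φ = z := by
  refine ⟨z.arg, ?_⟩
  have h1 : ‖z‖ = 1 := by simpa using hz
  have := Complex.norm_mul_exp_arg_mul_I z
  rwa [h1, Complex.ofReal_one, one_mul] at this

theorem le_circleMax {m : ℕ} {a b : ℝ} (ha : 0 ≤ a) (hb : 0 ≤ b) (θ : Fin m → ℝ) (φ : ℝ) :
    |jacobiWeight a b φ * nodeFun θ φ| ≤ circleMax a b θ := by
  rw [← nodeModulus_cis]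
  exact (circleMax_isGreatest ha hb θ).2 ⟨_, by simp [norm_cis], rfl⟩

theorem circleMax_le {m : ℕ} {a b M : ℝ} (ha : 0 ≤ a) (hb : 0 ≤ b) (θ : Fin m → ℝ)
    (h : ∀ φ, |jacobiWeight a b φ * nodeFun θ φ| ≤ M) : circleMax a b θ ≤ M := by
  obtain ⟨z, hz, hzE⟩ := (circleMax_isGreatest ha hb θ).1
  obtain ⟨φ, rfl⟩ := exists_cis_eq hz
  rw [← hzE, nodeModulus_cis]
  exact h φ

theorem exists_node_eq {m : ℕ} {θ : Fin m → ℝ} (hθ : ∀ k, θ k ∈ Set.Ico 0 (2 * Real.pi)) {s : ℝ}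
    (hs : s ∈ Set.Ico 0 (2 * Real.pi)) (h : nodeFun θ s = 0) : ∃ k, s = θ k := by
  obtain ⟨k, -, hk⟩ := Finset.prod_eq_zero_iff.1 ((mul_eq_zero.1 h).resolve_left (by positivity))
  refine ⟨k, ?_⟩
  rw [Real.sin_eq_zero_iff_of_lt_of_lt] at hk
  · linarith
  · linarith [hs.1, (hθ k).2]
  · linarith [hs.2, (hθ k).1]

theorem nodeFun_node {m : ℕ} (θ : Fin m → ℝ) (k : Fin m) : nodeFun θ (θ k) = 0 := by
  rw [nodeFun, Finset.prod_eq_zero (Finset.mem_univ k) (by simp), mul_zero]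

theorem cis_toIcoMod (t : ℝ) : cis (toIcoMod Real.two_pi_pos 0 t) = cis t := by
  have h : toIcoMod Real.two_pi_pos 0 t =
      t + ((-toIcoDiv Real.two_pi_pos 0 t : ℤ) : ℝ) * (2 * Real.pi) := by
    rw [toIcoMod, zsmul_eq_mul]; push_cast; ring
  have := Complex.exp_int_mul_two_pi_mul_I (-toIcoDiv Real.two_pi_pos 0 t)
  rw [h, cis_add, cis, cis]
  push_cast at this ⊢
  rw [← mul_assoc] at this
  rw [this, mul_one]

theorem mainTheorem7 (ρα ρβ : ℝ) (hα : 1 / 2 ≤ ρα) (hβ : 1 / 2 ≤ ρβ) (n : ℕ) :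
    ∃ θ : Fin (2 * n) → ℝ,
      ((∀ k, θ k ∈ Set.Ico 0 (2 * Real.pi)) ∧ IsMinimizingConfiguration ρα ρβ θ) ∧
      ∀ φ : Fin (2 * n) → ℝ,
        (∀ k, φ k ∈ Set.Ico 0 (2 * Real.pi)) → IsMinimizingConfiguration ρα ρβ φ →
          ∃ σ : Equiv.Perm (Fin (2 * n)), φ = θ ∘ σ := by
  have ha : 0 < ρα := by linarith
  have hb : 0 < ρβ := by linarith
  rcases Nat.eq_zero_or_pos n with rfl | hn
  · have hsub : Subsingleton (Fin (2 * 0) → ℝ) := by rw [mul_zero]; infer_instance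
    refine ⟨fun _ => 0, ⟨fun k => absurd k.2 (by simp), ⟨_, rfl⟩, ?_⟩, fun φ _ _ => ⟨1, ?_⟩⟩
    · rintro _ ⟨φ, rfl⟩
      exact (congrArg (circleMax ρα ρβ) (Subsingleton.elim _ φ)).le
    · exact Subsingleton.elim _ _
  obtain ⟨f₀, p₀, hf₀, hp₀⟩ := TrigRep.exists_lead hn 1
  obtain ⟨f, p, M, h⟩ := TrigRep.exists_isExtremal ha hb n (Λ := {z | 1 ≤ ‖z‖})
    (isClosed_le continuous_const continuous_norm) (by simp) hf₀ (by simp [hp₀])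
  obtain ⟨t, htinj, ht⟩ := h.exists_zeros ha hb hn
  set θ : Fin (2 * n) → ℝ := fun k => toIcoMod Real.two_pi_pos 0 (t k) with hθ
  have hθI : ∀ k, θ k ∈ Set.Ico 0 (2 * Real.pi) := fun k => by
    simpa using toIcoMod_mem_Ico Real.two_pi_pos 0 (t k)
  have hθinj : Function.Injective θ := fun i j hij => htinj (by
    simp only
    rw [← cis_toIcoMod, ← cis_toIcoMod (t j)]
    exact congrArg cis hij)
  have hθf : ∀ s, |nodeFun θ s| = |f s| := fun s => by
    rw [abs_nodeFun, ht]
    simp only [hθ, cis_toIcoMod]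
  -- Every configuration competes in the relaxed problem, and the zeros of f attain its minimum.
  have hge : ∀ φ : Fin (2 * n) → ℝ, M ≤ circleMax ρα ρβ φ := by
    intro φ
    obtain ⟨q, hq, hq1⟩ := exists_trigRep_nodeFun φ
    exact h.le _ _ _ hq hq1.ge (le_circleMax ha.le hb.le φ)
  have hle : circleMax ρα ρβ θ ≤ M := circleMax_le ha.le hb.le θ fun s => by
    rw [abs_mul, hθf, ← abs_mul]; exact h.bound s
  refine ⟨θ, ⟨hθI, ⟨θ, rfl⟩, ?_⟩, fun φ hφI hφ => ?_⟩
  · rintro _ ⟨φ, rfl⟩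
    exact hle.trans (hge φ)
  -- A second minimising configuration gives an extremal polynomial with the same modulus, hence the
  -- same zeros. The 2n nodes of θ are distinct and all occur among the 2n nodes of φ, so φ repeats
  -- none.
  obtain ⟨q, hq, hq1⟩ := exists_trigRep_nodeFun φ
  have hφM : circleMax ρα ρβ φ ≤ M := (hφ.2 ⟨θ, rfl⟩).trans hle
  have hext : IsExtremal ρα ρβ n {z | 1 ≤ ‖z‖} (nodeFun φ) q M :=
    { rep := hq
      lead := hq1.ge
      pos := h.pos
      bound := fun s => (le_circleMax ha.le hb.le φ s).trans hφM
      le := h.le }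
  have habs : ∀ s, |nodeFun φ s| = |nodeFun θ s| := fun s => by
    rw [hθf, h.abs_eq ha hb hn hext]
  have hex : ∀ k, ∃ j, φ k = θ j := fun k => by
    refine exists_node_eq hθI (hφI k) ?_
    rw [← abs_eq_zero, ← habs, nodeFun_node, abs_zero]
  choose σ hσ using hex
  have hsurj : Function.Surjective σ := by
    intro j
    obtain ⟨k, hk⟩ := exists_node_eq hφI (hθI j) (by
      rw [← abs_eq_zero, habs, nodeFun_node, abs_zero])
    exact ⟨k, hθinj (by rw [← hσ k, hk])⟩
  exact ⟨Equiv.ofBijective σ ⟨Finite.injective_iff_surjective.2 hsurj, hsurj⟩, funext hσ⟩
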